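/- Let $\mathsf e_1,\mathsf e_2$ be the standard basis of $\mathbb R^2$. A set is called Lipschitz if it is open and its boundary is locally the graph of a Lipschitz function (in suitable Cartesian coordinates), with the set lying locally on exactly one side of the graph. For $r\in(0,\infty)$ and $\theta\in\mathbb R$ let $$C_r(x_1,x_2):=\big(r(\cos(x_1/r)-1),\;r\sin(x_1/r),\;x_2\big)^{\mathsf T},\qquad \hat R_\theta:=\begin{pmatrix}\cos\theta&-\sin\theta&0\\ \sin\theta&\cos\theta&0\\0&0&1\end{pmatrix},$$ and for $v\in\mathbb R^3$ let $T_v:=\cdot+v$. For a bounded Lipschitz open set $S\subset\mathbb R^2$ let $W^{2,2}_{\rm iso}(S)$ be the set of $y\in W^{2,2}(S,\mathbb R^3)$ with $|\partial_1y|=|\partial_2y|=1$ and $\partial_1y\cdot\partial_2y=0$ a.e. in $S$. Let $\omega\subset\mathbb R^2$ be a bounded, open, connected, nonempty Lipschitz set. Let $\gamma:[0,1]\to\overline\omega$ be a continuous injective curve with image $[\gamma]$ such that $[\gamma]\cap\partial\omega=\{\gamma(0),\gamma(1)\}$ and such that $\omega\setminus[\gamma]$ has exactly two connected components $\omega_1$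 and $\omega_2$, both of which are Lipschitz. For $k=1,2$ let $y_k=T_{v_k}\circ R_k\circ C_{r_k}\circ\rho_k$ with $v_k\in\mathbb R^3$, $R_k\in SO(3)$, $r_k\in(0,\infty)$ and $\rho_k\in O(2)$, and suppose that $\det\rho_1=-\det\rho_2$ if $r_1=r_2$. Let $y:=y_1\chi_{\omega_1}+y_2\chi_{\omega_2}$ a.e. in $\omega$. Then $y\in W^{2,2}_{\rm iso}(\omega)$ if and only if there is $\mathsf e\in\mathbb R^2\setminus\{0\}$ such that the following conditions hold: (i) $[\gamma]$ is a line segment with direction $\mathsf e$; (ii) $\rho_1^{\mathsf T}\mathsf e_2$ and $\rho_2^{\mathsf T}\mathsf e_2$ are parallel to $\mathsf e$ (in particular, this implies $\rho_1\rho_2^{\mathsf T}=\mathrm{diag}(\sigma_1,\sigma_2)$ for some $\sigma_1,\sigma_2\in\{1,-1\}$); (iii) with $\sigma_1,\sigma_2$ as in (ii), $w_k:=\rho_k\gamma(0)$ and $\theta_k:=(w_k\cdot\mathsf e_1)/r_k$ for $k=1,2$, $$(R_1\hat R_{\theta_1})^{\mathsf T}(R_2\hat R_{\theta_2})=\mathrm{diag}(\sigma_1\sigma_2,\sigma_1,\sigma_2)\qquad\text{and}\qquad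 v_1+R_1C_{r_1}(w_1)=v_2+R_2C_{r_2}(w_2).$$ -/

import Mathlib

open MeasureTheory

namespace CylinderPatch

noncomputable section

/-- The Euclidean plane. -/
abbrev E2 := EuclideanSpace ℝ (Fin 2)

/-- Euclidean three-space. -/
abbrev E3 := EuclideanSpace ℝ (Fin 3)

/-- The standard basis vectors of the plane; `stdE 0` and `stdE 1` are the vectors
usually called `e₁` and `e₂`. -/
def stdE (i : Fin 2) : E2 := EuclideanSpace.single i 1

/-- An open set with Lipschitz boundary: near every boundary point `p` there are Cartesian
coordinates `z = A (x - p)` and a Lipschitz function `g` such that locally the set is exactly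
the region strictly above the graph of `g`. -/
def IsLipschitzOpen (Ω : Set E2) : Prop :=
  IsOpen Ω ∧ ∀ p ∈ frontier Ω, ∃ (A : E2 ≃ₗᵢ[ℝ] E2) (K : NNReal) (g : ℝ → ℝ) (U : Set E2),
    LipschitzWith K g ∧ IsOpen U ∧ p ∈ U ∧
      ∀ x ∈ U, (x ∈ Ω ↔ g ((A (x - p)) 0) < (A (x - p)) 1)

/-- `C` is one of the connected components of the set `S`. -/
def IsComponentOf (C S : Set E2) : Prop := ∃ x ∈ S, connectedComponentIn S x = C

/-- `g` is the `i`-th weak partial derivative of `f` on the open set `Ω`: integration by parts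
against all smooth scalar test functions with compact support contained in `Ω`. It is
used only for functions `f`, `g` that are square integrable on `Ω`. -/
def IsWeakPartial (Ω : Set E2) (i : Fin 2) (f g : E2 → E3) : Prop :=
  ∀ φ : E2 → ℝ, ContDiff ℝ (⊤ : ℕ∞) φ → HasCompactSupport φ → tsupport φ ⊆ Ω →
    ∫ x in Ω, (fderiv ℝ φ x (stdE i)) • f x = - ∫ x in Ω, φ x • g x

/-- `y` belongs to `W^{2,2}(Ω, ℝ³)`, with first weak partial derivatives `d 0`, `d 1`. -/
def MemW22With (Ω : Set E2) (y : E2 → E3) (d : Fin 2 → E2 → E3) : Prop :=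
  MemLp y 2 (volume.restrict Ω) ∧
  (∀ i, MemLp (d i) 2 (volume.restrict Ω) ∧ IsWeakPartial Ω i y (d i)) ∧
  ∃ h : Fin 2 → Fin 2 → E2 → E3,
    ∀ i j, MemLp (h i j) 2 (volume.restrict Ω) ∧ IsWeakPartial Ω j (d i) (h i j)

/-- `y` belongs to `W^{2,2}_iso(Ω)`: it is a `W^{2,2}` map into `ℝ³` with
`|∂₁y| = |∂₂y| = 1` and `∂₁y · ∂₂y = 0` almost everywhere in `Ω`. -/
def MemW22Iso (Ω : Set E2) (y : E2 → E3) : Prop :=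
  ∃ d : Fin 2 → E2 → E3, MemW22With Ω y d ∧
    ∀ᵐ x ∂(volume.restrict Ω), ‖d 0 x‖ = 1 ∧ ‖d 1 x‖ = 1 ∧ inner ℝ (d 0 x) (d 1 x) = 0

/-- The standard (vertical) cylinder map `C_r` of finite radius `r`. -/
def stdCyl (r : ℝ) (x : E2) : E3 :=
  !₂[r * (Real.cos (x 0 / r) - 1), r * Real.sin (x 0 / r), x 1]

/-- The cylinder `T_v ∘ R ∘ C_r ∘ ρ`. -/
def cyl (v : E3) (R : Matrix (Fin 3) (Fin 3) ℝ) (r : ℝ) (ρ : Matrix (Fin 2) (Fin 2) ℝ)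
    (x : E2) : E3 :=
  v + R.toEuclideanLin (stdCyl r (ρ.toEuclideanLin x))

/-- The rotation by the angle `θ` about the third axis of `ℝ³`. -/
def rotZ (θ : ℝ) : Matrix (Fin 3) (Fin 3) ℝ :=
  !![Real.cos θ, -Real.sin θ, 0; Real.sin θ, Real.cos θ, 0; 0, 0, 1]

/-- `S` is a (nondegenerate) line segment with direction `e`. -/
def IsSegmentAlong (S : Set E2) (e : E2) : Prop :=
  ∃ (p : E2) (l : ℝ), 0 < l ∧ S = segment ℝ p (p + l • e)

/-- The vector `ρᵀ e₂`, the direction of the rulings of a cylinder `T_v ∘ R ∘ C_r ∘ ρ`. -/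
def ruling (ρ : Matrix (Fin 2) (Fin 2) ℝ) : E2 := ρ.transpose.toEuclideanLin (stdE 1)

/-- The vector `a` is parallel to the vector `e` (meant for `e ≠ 0`). -/
def IsParallel (a e : E2) : Prop := ∃ c : ℝ, a = c • e

/-- The angle `θ = (w · e₁) / r`, for `w = ρ p`. -/
def angleAt (r : ℝ) (ρ : Matrix (Fin 2) (Fin 2) ℝ) (p : E2) : ℝ :=
  (ρ.toEuclideanLin p) 0 / r

end

end CylinderPatch

open CylinderPatch

/-!
Write `y₁`, `y₂` for the two cylinders and `P = ρ₁ ρ₂ᵀ`. The map `y` glued from them lies in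
`W^{2,2}` exactly when `y₁ = y₂` and `∇y₁ = ∇y₂` along the curve, and this first-order contact is
then decided by linear algebra.

*Contact is sufficient.* Both `y` and its piecewise gradient are glued from smooth functions which
agree off `ω₁ ∪ ω₂`. A test function times such a glued function is Lipschitz on the whole plane,
since a segment from `ω₁` to `ω₂` leaves `ω₁ ∪ ω₂` (`lipschitzWith_piecewise`), so
integration by parts for Lipschitz functions gives the weak derivatives
(`isWeakPartial_piecewise`). No regularity of the interface is used here beyond its being null.

*Contact is necessary.* If a component `f` of the jump `y₁ - y₂` is nonzero at a point `q` of the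
curve, testing with `ψ / f` shows that `∫_{ω₁} ∂ψ = 0` for all test functions `ψ` supported near
`q`; so one of `ω₁`, `ω₂` is empty near `q` (`not_exterior_of_integral_fderiv_eq_zero`). As
the curve is null, `q` would be a slit of the other set, which a Lipschitz set does not have
(`IsLipschitzOpen.exists_isOpen_exterior`). The same applies to the gradients
(`eq_of_isWeakPartial_piecewise`). The curve is null although a general arc need not be: an arc
has empty interior (`interior_range_arc`), so the curve is covered by the boundaries of `ω₁` and
`ω₂`, which have dimension at most one (`volume_sdiff_components`).

*Linear algebra.* The gradients agree at `x` if and only if the frames `R_k * rotZ θ_k(x)` differ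
by `D = diag(det P, P)` (`cylD_eq_iff`). Comparing two points of the curve gives
`rotZ α * D = D * rotZ β` for the increments `α`, `β` of the two angles. If `P` is not diagonal,
both increments are multiples of `2π`, hence zero by continuity, and the curve would be a point. If
`P = diag(σ₁, σ₂)`, then `α = σ₂ β` by the same argument, and since the radii or the orientations
differ this forces `β = 0`: the curve runs along a common ruling (`contact_along_ruling`).
Conversely, contact at one point propagates along a common ruling
(`contact_of_contact_at_point`).
-/

namespace CylinderPatch

open Set Filter Topology

/-! ### Arcs and Lipschitz boundaries in the plane -/

/-- The plane does not embed into the line: removing a point disconnects an interval, but not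
the plane. -/
theorem not_injective_of_continuous_real {f : E2 → ℝ} (hf : Continuous f) :
    ¬ Function.Injective f := by
  intro hinj
  have hrank : 1 < Module.rank ℝ E2 := by
    apply Module.one_lt_rank_of_one_lt_finrank
    simp
  obtain ⟨a, b, hab⟩ : ∃ a b : E2, f a < f b := by
    have hne : f (stdE 0) ≠ f 0 := fun h => by
      have := congrArg (fun v : E2 => v 0) (hinj h)
      simp [stdE] at this
    rcases lt_or_gt_of_ne hne with h | h
    exacts [⟨_, _, h⟩, ⟨_, _, h⟩]
  -- the fibre over the midpoint of two values is the point to remove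
  obtain ⟨c, -, hc⟩ : ∃ c ∈ univ, f c = (f a + f b) / 2 :=
    isPreconnected_univ.intermediate_value (mem_univ a) (mem_univ b) hf.continuousOn
      ⟨by linarith, by linarith⟩
  have hca : a ≠ c := by rintro rfl; linarith
  have hcb : b ≠ c := by rintro rfl; linarith
  obtain ⟨d, hd, hdc⟩ :=
    (isConnected_compl_singleton_of_one_lt_rank hrank c).isPreconnected.intermediate_value
      (show a ∈ ({c}ᶜ : Set E2) from hca) (show b ∈ ({c}ᶜ : Set E2) from hcb) hf.continuousOn
      (show f c ∈ Icc (f a) (f b) from ⟨by linarith, by linarith⟩)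
  exact hd (hinj hdc)

/-- An arc in the plane has empty interior (although it may have positive area). -/
theorem interior_range_arc {γ : unitInterval → E2} (hc : Continuous γ)
    (hi : Function.Injective γ) : interior (range γ) = ∅ := by
  by_contra hne
  obtain ⟨q, hq⟩ := nonempty_iff_ne_empty.2 hne
  obtain ⟨ε, hε, hball⟩ := Metric.isOpen_iff.1 isOpen_interior q hq
  let e := OpenPartialHomeomorph.univBall q ε
  have hmem : ∀ x, e x ∈ range γ := fun x => interior_subset (hball (by
    have := e.map_source (x := x) (by simp [e])
    simpa [e, OpenPartialHomeomorph.univBall_target q hε] using this))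
  let s := (hc.isClosedEmbedding hi).isEmbedding.toHomeomorph
  have hcont : Continuous e := OpenPartialHomeomorph.continuous_univBall q ε
  refine not_injective_of_continuous_real
    (f := fun x => ((s.symm ⟨e x, hmem x⟩ : unitInterval) : ℝ)) ?_ ?_
  · exact continuous_subtype_val.comp
      (s.symm.continuous.comp (hcont.subtype_mk hmem))
  · intro x x' h
    have h1 := s.symm.injective (Subtype.ext h)
    exact e.injOn (by simp [e]) (by simp [e]) (congrArg Subtype.val h1)

/-- The boundary of a Lipschitz set is locally contained in a Lipschitz image of the line, so it
has Hausdorff dimension at most one. -/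
theorem IsLipschitzOpen.volume_frontier {Ω : Set E2} (h : IsLipschitzOpen Ω) :
    volume (frontier Ω) = 0 := by
  apply measure_null_of_locally_null
  intro p hp
  obtain ⟨A, K, g, U, hg, hU, hpU, hA⟩ := h.2 p hp
  refine ⟨frontier Ω ∩ U, inter_mem self_mem_nhdsWithin
    (mem_nhdsWithin_of_mem_nhds (hU.mem_nhds hpU)), ?_⟩
  let G : ℝ → E2 := fun s => p + A.symm (WithLp.toLp 2 ![s, g s])
  have hv : LipschitzWith (max 1 K) (fun s : ℝ => (![s, g s] : Fin 2 → ℝ)) := by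
    apply LipschitzWith.of_dist_le_mul
    intro s t
    rw [dist_pi_le_iff (by positivity)]
    intro i
    fin_cases i
    · simpa using le_mul_of_one_le_left (dist_nonneg (x := s) (y := t))
        (by simp : (1 : ℝ) ≤ max 1 (K : ℝ))
    · exact (hg.dist_le_mul s t).trans
        (mul_le_mul_of_nonneg_right (by simp) dist_nonneg)
  have hG : LipschitzWith _ G :=
    (LipschitzWith.const p).add (A.symm.lipschitz.comp
      ((PiLp.lipschitzWith_toLp 2 (fun _ : Fin 2 => ℝ)).comp hv))
  have hsub : frontier Ω ∩ U ⊆ range G := by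
    rintro x ⟨hx, hxU⟩
    refine ⟨A (x - p) 0, ?_⟩
    have hle : A (x - p) 1 ≤ g (A (x - p) 0) := by
      have hxn : x ∉ Ω := by
        rw [h.1.frontier_eq] at hx
        exact hx.2
      exact not_lt.1 fun hlt => hxn ((hA x hxU).2 hlt)
    have hge : g (A (x - p) 0) ≤ A (x - p) 1 := by
      by_contra hlt
      have hcg := hg.continuous
      have hop : IsOpen {z : E2 | A (z - p) 1 < g (A (z - p) 0)} :=
        isOpen_lt (by fun_prop) (by fun_prop)
      obtain ⟨z, ⟨hz, hzU⟩, hzΩ⟩ := mem_closure_iff.1 (frontier_subset_closure hx) _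
        (hop.inter hU) ⟨not_le.1 hlt, hxU⟩
      exact lt_asymm hz ((hA z hzU).1 hzΩ)
    have : (WithLp.toLp 2 ![A (x - p) 0, g (A (x - p) 0)] : E2) = A (x - p) := by
      ext i
      fin_cases i
      · rfl
      · simpa using le_antisymm hge hle
    simp only [G, this]
    simp
  have hdim : dimH (frontier Ω ∩ U) < ((2 : NNReal) : ENNReal) := by
    calc dimH (frontier Ω ∩ U) ≤ dimH (range G) := dimH_mono hsub
      _ ≤ dimH (univ : Set ℝ) := hG.dimH_range_le
      _ = 1 := Real.dimH_univ
      _ < _ := by norm_num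
  have : (MeasureTheory.Measure.hausdorffMeasure (2 : NNReal) : Measure E2).IsAddHaarMeasure := by
    simpa using isAddHaarMeasure_hausdorffMeasure (E := E2)
  exact measure_zero_of_dimH_lt
    (MeasureTheory.Measure.absolutelyContinuous_isAddHaarMeasure volume _) hdim

/-- A Lipschitz set has no slits: every boundary point is a limit of exterior points. -/
theorem IsLipschitzOpen.exists_isOpen_exterior {Ω : Set E2} (h : IsLipschitzOpen Ω) {p : E2}
    (hp : p ∈ frontier Ω) {V : Set E2} (hV : IsOpen V) (hpV : p ∈ V) :
    ∃ W : Set E2, IsOpen W ∧ W.Nonempty ∧ W ⊆ V ∧ Disjoint W Ω := by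
  obtain ⟨A, K, g, U, hg, hU, hpU, hA⟩ := h.2 p hp
  have hcg := hg.continuous
  refine ⟨{z : E2 | A (z - p) 1 < g (A (z - p) 0)} ∩ U ∩ V,
    ((isOpen_lt (by fun_prop) (by fun_prop)).inter hU).inter hV, ?_, inter_subset_right, ?_⟩
  · have h0 : 0 ≤ g 0 := by
      have hpn : p ∉ Ω := by
        rw [h.1.frontier_eq] at hp
        exact hp.2
      exact not_lt.1 fun hlt => hpn ((hA p hpU).2 (by simpa using hlt))
    let c : ℝ → E2 := fun t => p + A.symm (t • EuclideanSpace.single 1 1)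
    have hc : Continuous c := by fun_prop
    have hc0 : c 0 = p := by simp [c]
    have hev : ∀ᶠ t in 𝓝[<] (0 : ℝ), c t ∈ U ∩ V :=
      (hc.tendsto 0).mono_left nhdsWithin_le_nhds
        ((hU.inter hV).mem_nhds (by rw [hc0]; exact ⟨hpU, hpV⟩))
    obtain ⟨t, htUV, ht⟩ := (hev.and self_mem_nhdsWithin).exists
    refine ⟨c t, ⟨?_, htUV.1⟩, htUV.2⟩
    have ht' : t < 0 := ht
    simp only [c, mem_ofPred_eq, add_sub_cancel_left, LinearIsometryEquiv.apply_symm_apply]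
    simpa using ht'.trans_le h0
  · rw [Set.disjoint_left]
    rintro z ⟨⟨hz, hzU⟩, -⟩ hzΩ
    exact lt_asymm hz ((hA z hzU).1 hzΩ)

/-! ### Gluing along the complement of two disjoint open sets -/

/-- Two Lipschitz functions which agree off the disjoint open sets `U₁` and `U₂` glue to a
Lipschitz function: a segment from `U₁` to `U₂` leaves `U₁ ∪ U₂`. -/
theorem lipschitzWith_piecewise {U₁ U₂ : Set E2} (h₁ : IsOpen U₁) (h₂ : IsOpen U₂)
    (hd : Disjoint U₁ U₂) {G₁ G₂ : E2 → ℝ} {C : NNReal} (hG₁ : LipschitzWith C G₁)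
    (hG₂ : LipschitzWith C G₂) (heq : ∀ x, x ∉ U₁ → x ∉ U₂ → G₁ x = G₂ x)
    [DecidablePred (· ∈ U₁)] : LipschitzWith C (U₁.piecewise G₁ G₂) := by
  have key : ∀ x ∈ U₁, ∀ z, z ∉ U₁ → dist (G₁ x) (G₂ z) ≤ C * dist x z := by
    intro x hx z hz
    obtain ⟨q, hq, hq₁, hq₂⟩ : ∃ q ∈ segment ℝ x z, q ∉ U₁ ∧ q ∉ U₂ := by
      by_cases hz₂ : z ∈ U₂
      · by_contra! hcon
        obtain ⟨q, -, hq₁, hq₂⟩ := (convex_segment x z).isPreconnected U₁ U₂ h₁ h₂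
          (fun q hq => or_iff_not_imp_left.2 (hcon q hq))
          ⟨x, left_mem_segment ℝ x z, hx⟩ ⟨z, right_mem_segment ℝ x z, hz₂⟩
        exact hd.le_bot ⟨hq₁, hq₂⟩
      · exact ⟨z, right_mem_segment ℝ x z, hz, hz₂⟩
    calc dist (G₁ x) (G₂ z) ≤ dist (G₁ x) (G₁ q) + dist (G₁ q) (G₂ z) := dist_triangle _ _ _
      _ ≤ C * dist x q + C * dist q z := by
        rw [heq q hq₁ hq₂]
        gcongr
        · rw [← heq q hq₁ hq₂]; exact hG₁.dist_le_mul _ _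
        · exact hG₂.dist_le_mul _ _
      _ = C * dist x z := by rw [← mul_add, dist_add_dist_of_mem_segment hq]
  apply LipschitzWith.of_dist_le_mul
  intro x z
  by_cases hx : x ∈ U₁ <;> by_cases hz : z ∈ U₁
  · simpa [hx, hz] using hG₁.dist_le_mul x z
  · simpa [hx, hz] using key x hx z hz
  · simpa [hx, hz, dist_comm] using key z hz x hx
  · simpa [hx, hz] using hG₂.dist_le_mul x z

/-- The divergence theorem for glued `C¹` functions: the two boundary contributions cancel.
The glued function is Lipschitz, so integration by parts against the constant `1` applies. -/
theorem integral_fderiv_add_integral_fderiv_eq_zero {Ω U₁ U₂ : Set E2}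
    (h₁ : IsOpen U₁) (h₂ : IsOpen U₂) (hd : Disjoint U₁ U₂)
    (hnull : volume (Ω \ (U₁ ∪ U₂)) = 0) {G₁ G₂ : E2 → ℝ}
    (hG₁ : ContDiff ℝ 1 G₁) (hG₂ : ContDiff ℝ 1 G₂)
    (hc₁ : HasCompactSupport G₁) (hc₂ : HasCompactSupport G₂)
    (hs₁ : tsupport G₁ ⊆ Ω) (hs₂ : tsupport G₂ ⊆ Ω)
    (heq : ∀ x ∈ Ω, x ∉ U₁ → x ∉ U₂ → G₁ x = G₂ x) (v : E2) :
    (∫ x in U₁, fderiv ℝ G₁ x v) + (∫ x in U₂, fderiv ℝ G₂ x v) = 0 := by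
  classical
  obtain ⟨C₁, hL₁⟩ := hG₁.lipschitzWith_of_hasCompactSupport hc₁ one_ne_zero
  obtain ⟨C₂, hL₂⟩ := hG₂.lipschitzWith_of_hasCompactSupport hc₂ one_ne_zero
  have heq' : ∀ x, x ∉ U₁ → x ∉ U₂ → G₁ x = G₂ x := by
    intro x hx₁ hx₂
    by_cases hx : x ∈ Ω
    · exact heq x hx hx₁ hx₂
    · rw [image_eq_zero_of_notMem_tsupport fun h => hx (hs₁ h),
        image_eq_zero_of_notMem_tsupport fun h => hx (hs₂ h)]
  let w := U₁.piecewise G₁ G₂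
  have hw : LipschitzWith (max C₁ C₂) w :=
    lipschitzWith_piecewise h₁ h₂ hd (hL₁.weaken (le_max_left _ _))
      (hL₂.weaken (le_max_right _ _)) heq'
  have hw0 : ∀ x, x ∉ tsupport G₁ ∪ tsupport G₂ → w x = 0 := by
    intro x hx
    rw [mem_union, not_or] at hx
    by_cases h : x ∈ U₁
    · simp [w, h, image_eq_zero_of_notMem_tsupport hx.1]
    · simp [w, h, image_eq_zero_of_notMem_tsupport hx.2]
  have hwc : HasCompactSupport w :=
    HasCompactSupport.intro (hc₁.isCompact.union hc₂.isCompact) hw0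
  have hint : ∫ x, lineDeriv ℝ w x v = 0 := by
    have := LipschitzWith.integral_lineDeriv_mul_eq (μ := (volume : Measure E2))
      (LipschitzWith.const (1 : ℝ) : LipschitzWith 0 fun _ : E2 => (1 : ℝ)) hw hwc (-v)
    simpa [lineDeriv] using this.symm
  have hae : (fun x => lineDeriv ℝ w x v) =ᵐ[volume] fun x =>
      U₁.indicator (fun x => fderiv ℝ G₁ x v) x + U₂.indicator (fun x => fderiv ℝ G₂ x v) x := by
    filter_upwards [compl_mem_ae_iff.2 hnull] with x hx
    by_cases hx₁ : x ∈ U₁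
    · have hx₂ : x ∉ U₂ := fun h => hd.le_bot ⟨hx₁, h⟩
      have : w =ᶠ[𝓝 x] G₁ := by
        filter_upwards [h₁.mem_nhds hx₁] with z hz
        simp [w, hz]
      simp only [hx₁, hx₂, indicator_of_mem, indicator_of_notMem, not_false_eq_true, add_zero]
      rw [this.lineDeriv_eq]
      exact ((hG₁.differentiable one_ne_zero) x).lineDeriv_eq_fderiv
    · by_cases hx₂ : x ∈ U₂
      · have : w =ᶠ[𝓝 x] G₂ := by
          filter_upwards [h₂.mem_nhds hx₂] with z hz
          have : z ∉ U₁ := fun h => hd.le_bot ⟨h, hz⟩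
          simp [w, this]
        simp only [hx₁, hx₂, indicator_of_mem, indicator_of_notMem, not_false_eq_true, zero_add]
        rw [this.lineDeriv_eq]
        exact ((hG₂.differentiable one_ne_zero) x).lineDeriv_eq_fderiv
      · have hxΩ : x ∉ Ω := fun h => hx ⟨h, by simp [hx₁, hx₂]⟩
        have : w =ᶠ[𝓝 x] fun _ => 0 := by
          have hcl : IsClosed (tsupport G₁ ∪ tsupport G₂) :=
            (isClosed_tsupport _).union (isClosed_tsupport _)
          filter_upwards [hcl.isOpen_compl.mem_nhds
            (show x ∈ (tsupport G₁ ∪ tsupport G₂)ᶜ from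
              fun h => hxΩ (union_subset hs₁ hs₂ h))] with z hz
          exact hw0 z hz
        rw [this.lineDeriv_eq]
        simp [hx₁, hx₂, lineDeriv]
  have hi : ∀ {G : E2 → ℝ}, ContDiff ℝ 1 G → HasCompactSupport G →
      Integrable (fun x => fderiv ℝ G x v) := fun {G} hG hc =>
    ((hG.continuous_fderiv one_ne_zero).clm_apply continuous_const).integrable_of_hasCompactSupport
      (hc.fderiv_apply ℝ v)
  rw [integral_congr_ae hae, integral_add ((hi hG₁ hc₁).indicator h₁.measurableSet)
    ((hi hG₂ hc₂).indicator h₂.measurableSet), integral_indicator h₁.measurableSet,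
    integral_indicator h₂.measurableSet] at hint
  exact hint

/-- The vector-valued form of the divergence theorem for glued functions, for products with a
test function. -/
theorem integral_fderiv_smul_add_eq_zero {Ω U₁ U₂ : Set E2}
    (h₁ : IsOpen U₁) (h₂ : IsOpen U₂) (hd : Disjoint U₁ U₂)
    (hnull : volume (Ω \ (U₁ ∪ U₂)) = 0) {u₁ u₂ : E2 → E3}
    (hu₁ : ContDiff ℝ 1 u₁) (hu₂ : ContDiff ℝ 1 u₂)
    (heq : ∀ x ∈ Ω, x ∉ U₁ → x ∉ U₂ → u₁ x = u₂ x)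
    {φ : E2 → ℝ} (hφ : ContDiff ℝ (⊤ : ℕ∞) φ) (hφc : HasCompactSupport φ)
    (hφs : tsupport φ ⊆ Ω) (v : E2) :
    (∫ x in U₁, fderiv ℝ (fun x => φ x • u₁ x) x v) +
      (∫ x in U₂, fderiv ℝ (fun x => φ x • u₂ x) x v) = 0 := by
  have hφ1 : ContDiff ℝ 1 φ := hφ.of_le (by exact_mod_cast le_top)
  have hi : ∀ {u : E2 → E3}, ContDiff ℝ 1 u →
      Integrable (fun x => fderiv ℝ (fun x => φ x • u x) x v) := fun {u} hu =>
    (((hφ1.smul hu).continuous_fderiv one_ne_zero).clm_apply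
      continuous_const).integrable_of_hasCompactSupport
      ((hφc.smul_right (f' := u)).fderiv_apply ℝ v)
  have hcomp : ∀ {u : E2 → E3}, ContDiff ℝ 1 u → ∀ (c : Fin 3) (S : Set E2),
      (∫ x in S, fderiv ℝ (fun x => φ x • u x) x v) c =
        ∫ x in S, fderiv ℝ (fun x => φ x * u x c) x v := by
    intro u hu c S
    have := (EuclideanSpace.proj c : E3 →L[ℝ] ℝ).integral_comp_comm
      ((hi hu).integrableOn (s := S))
    refine this.symm.trans ?_
    congr 1
    ext x
    have hdiff : DifferentiableAt ℝ (fun x => φ x • u x) x :=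
      ((hφ1.smul hu).differentiable one_ne_zero) x
    have := ((EuclideanSpace.proj c : E3 →L[ℝ] ℝ).hasFDerivAt.comp x
      hdiff.hasFDerivAt).fderiv
    exact (congrArg (fun L : E2 →L[ℝ] ℝ => L v) this).symm
  ext c
  rw [PiLp.add_apply, hcomp hu₁, hcomp hu₂]
  have huc : ∀ {u : E2 → E3}, ContDiff ℝ 1 u → ContDiff ℝ 1 (fun x => φ x * u x c) :=
    fun {u} hu => hφ1.mul ((EuclideanSpace.proj c : E3 →L[ℝ] ℝ).contDiff.comp hu)
  exact integral_fderiv_add_integral_fderiv_eq_zero h₁ h₂ hd hnull (huc hu₁) (huc hu₂)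
    (hφc.mul_right (f' := fun x => u₁ x c)) (hφc.mul_right (f' := fun x => u₂ x c))
    ((tsupport_mul_subset_left (f := φ) (g := fun x => u₁ x c)).trans hφs)
    ((tsupport_mul_subset_left (f := φ) (g := fun x => u₂ x c)).trans hφs)
    (fun x hx hx₁ hx₂ => by simp only [heq x hx hx₁ hx₂]) v

/-! ### Weak derivatives of piecewise smooth maps -/

/-- Integrals against a function given piecewise almost everywhere split into two pieces; the
remainder of `Ω` contributes nothing as both indicators vanish there. -/
theorem setIntegral_smul_piecewise {Ω U₁ U₂ : Set E2} (h₁ : IsOpen U₁) (h₂ : IsOpen U₂)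
    (hs₁ : U₁ ⊆ Ω) (hs₂ : U₂ ⊆ Ω) {u u₁ u₂ : E2 → E3} (hu₁ : Continuous u₁)
    (hu₂ : Continuous u₂)
    (hu : u =ᵐ[volume.restrict Ω] fun x => U₁.indicator u₁ x + U₂.indicator u₂ x)
    {ψ : E2 → ℝ} (hψ : Continuous ψ) (hψc : HasCompactSupport ψ) :
    ∫ x in Ω, ψ x • u x = (∫ x in U₁, ψ x • u₁ x) + ∫ x in U₂, ψ x • u₂ x := by
  have hi : ∀ {u : E2 → E3}, Continuous u → Integrable (fun x => ψ x • u x) := fun {u} hu =>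
    (hψ.smul hu).integrable_of_hasCompactSupport hψc.smul_right
  have hae : (fun x => ψ x • u x) =ᵐ[volume.restrict Ω] fun x =>
      U₁.indicator (fun x => ψ x • u₁ x) x + U₂.indicator (fun x => ψ x • u₂ x) x := by
    filter_upwards [hu] with x hx
    rw [hx, smul_add]
    simp only [indicator_smul_apply]
  rw [integral_congr_ae hae, integral_add
    ((hi hu₁).integrableOn.indicator h₁.measurableSet)
    ((hi hu₂).integrableOn.indicator h₂.measurableSet),
    setIntegral_indicator h₁.measurableSet, setIntegral_indicator h₂.measurableSet,
    inter_eq_self_of_subset_right hs₁, inter_eq_self_of_subset_right hs₂]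

theorem setIntegral_fderiv_smul {φ : E2 → ℝ} (hφ : ContDiff ℝ (⊤ : ℕ∞) φ)
    (hφc : HasCompactSupport φ) {u : E2 → E3} (hu : ContDiff ℝ 1 u) (S : Set E2) (v : E2) :
    ∫ x in S, fderiv ℝ (fun x => φ x • u x) x v =
      (∫ x in S, fderiv ℝ φ x v • u x) + ∫ x in S, φ x • fderiv ℝ u x v := by
  have hφ1 : ContDiff ℝ 1 φ := hφ.of_le (by exact_mod_cast le_top)
  rw [← integral_add]
  · congr 1
    ext1 x
    rw [fderiv_fun_smul (hφ1.differentiable one_ne_zero x) (hu.differentiable one_ne_zero x)]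
    simp [add_comm]
  · exact ((((hφ1.continuous_fderiv one_ne_zero).clm_apply continuous_const).smul
      hu.continuous).integrable_of_hasCompactSupport
        ((hφc.fderiv_apply ℝ v).smul_right)).integrableOn
  · exact ((hφ1.continuous.smul ((hu.continuous_fderiv one_ne_zero).clm_apply
      continuous_const)).integrable_of_hasCompactSupport hφc.smul_right).integrableOn

/-- A piecewise `C¹` map without jump has its piecewise derivative as weak derivative. -/
theorem isWeakPartial_piecewise {Ω U₁ U₂ : Set E2} (h₁ : IsOpen U₁) (h₂ : IsOpen U₂)
    (hs₁ : U₁ ⊆ Ω) (hs₂ : U₂ ⊆ Ω) (hd : Disjoint U₁ U₂)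
    (hnull : volume (Ω \ (U₁ ∪ U₂)) = 0) {u g u₁ u₂ : E2 → E3}
    (hu₁ : ContDiff ℝ 1 u₁) (hu₂ : ContDiff ℝ 1 u₂)
    (hu : u =ᵐ[volume.restrict Ω] fun x => U₁.indicator u₁ x + U₂.indicator u₂ x) (i : Fin 2)
    (hg : g =ᵐ[volume.restrict Ω] fun x => U₁.indicator (fun x => fderiv ℝ u₁ x (stdE i)) x +
      U₂.indicator (fun x => fderiv ℝ u₂ x (stdE i)) x)
    (heq : ∀ x ∈ Ω, x ∉ U₁ → x ∉ U₂ → u₁ x = u₂ x) : IsWeakPartial Ω i u g := by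
  intro φ hφ hφc hφs
  have hφ1 : ContDiff ℝ 1 φ := hφ.of_le (by exact_mod_cast le_top)
  have hdiv := integral_fderiv_smul_add_eq_zero h₁ h₂ hd hnull hu₁ hu₂ heq hφ hφc hφs (stdE i)
  rw [setIntegral_fderiv_smul hφ hφc hu₁, setIntegral_fderiv_smul hφ hφc hu₂] at hdiv
  rw [setIntegral_smul_piecewise h₁ h₂ hs₁ hs₂ hu₁.continuous hu₂.continuous hu
      ((hφ1.continuous_fderiv one_ne_zero).clm_apply continuous_const)
      (hφc.fderiv_apply ℝ (stdE i)),
    setIntegral_smul_piecewise h₁ h₂ hs₁ hs₂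
      ((hu₁.continuous_fderiv one_ne_zero).clm_apply continuous_const)
      ((hu₂.continuous_fderiv one_ne_zero).clm_apply continuous_const) hg hφ1.continuous hφc,
    eq_neg_iff_add_eq_zero, ← hdiv]
  abel

theorem IsWeakPartial.mono {Ω U : Set E2} {i : Fin 2} {u g : E2 → E3}
    (h : IsWeakPartial Ω i u g) (hU : U ⊆ Ω) : IsWeakPartial U i u g := by
  intro φ hφ hφc hφs
  have h0 : ∀ x ∉ U, φ x = 0 := fun x hx => image_eq_zero_of_notMem_tsupport fun h => hx (hφs h)
  have h0' : ∀ x ∉ U, fderiv ℝ φ x = 0 := fun x hx =>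
    image_eq_zero_of_notMem_tsupport fun h => hx (hφs (tsupport_fderiv_subset ℝ h))
  have := h φ hφ hφc (hφs.trans hU)
  have e : ∀ S : Set E2, U ⊆ S →
      (∫ x in S, fderiv ℝ φ x (stdE i) • u x = ∫ x, fderiv ℝ φ x (stdE i) • u x) ∧
      ∫ x in S, φ x • g x = ∫ x, φ x • g x := fun S hS =>
    ⟨setIntegral_eq_integral_of_forall_compl_eq_zero
        fun x hx => by simp [h0' x fun h => hx (hS h)],
      setIntegral_eq_integral_of_forall_compl_eq_zero
        fun x hx => by simp [h0 x fun h => hx (hS h)]⟩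
  rw [(e U subset_rfl).1, (e U subset_rfl).2, ← (e Ω hU).1, ← (e Ω hU).2]
  exact this

/-- Weak derivatives agree with classical ones. -/
theorem IsWeakPartial.ae_eq_fderiv {U : Set E2} (hU : IsOpen U) {i : Fin 2} {u g u₁ : E2 → E3}
    (h : IsWeakPartial U i u g) (hu₁ : ContDiff ℝ 1 u₁) (hu : u =ᵐ[volume.restrict U] u₁)
    (hg : LocallyIntegrableOn g U) :
    g =ᵐ[volume.restrict U] fun x => fderiv ℝ u₁ x (stdE i) := by
  have hcd : Continuous fun x => fderiv ℝ u₁ x (stdE i) :=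
    (hu₁.continuous_fderiv one_ne_zero).clm_apply continuous_const
  -- the glued case with an empty second piece
  have hcl : IsWeakPartial U i u (fun x => fderiv ℝ u₁ x (stdE i)) :=
    isWeakPartial_piecewise (U₁ := U) (U₂ := ∅) (u₂ := 0) hU isOpen_empty subset_rfl
      (empty_subset _) (disjoint_bot_right) (by simp) hu₁ contDiff_const
      (by
        filter_upwards [hu, self_mem_ae_restrict hU.measurableSet] with x hx hxU
        simp [hx, hxU]) i
      (by
        filter_upwards [self_mem_ae_restrict hU.measurableSet] with x hxU
        simp [hxU])
      (fun x hx hx' => absurd hx hx')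
  have := hU.ae_eq_zero_of_integral_contDiff_smul_eq_zero (μ := volume)
    (f := fun x => g x - fderiv ℝ u₁ x (stdE i))
    (hg.sub (hcd.locallyIntegrable.locallyIntegrableOn U)) (by
      intro φ hφ hφc hφs
      have h0 : ∀ x ∉ U, φ x • (g x - fderiv ℝ u₁ x (stdE i)) = 0 := fun x hx => by
        rw [image_eq_zero_of_notMem_tsupport fun h => hx (hφs h), zero_smul]
      rw [← setIntegral_eq_integral_of_forall_compl_eq_zero h0]
      simp only [smul_sub]
      have h1 : IntegrableOn (fun x => φ x • g x) U := by
        have hK := hg.integrableOn_compact_subset hφs hφc.isCompact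
        have : IntegrableOn (fun x => φ x • g x) (tsupport φ) :=
          hK.continuousOn_smul hφ.continuous.continuousOn hφc.isCompact
        exact ((integrableOn_iff_integrable_of_support_subset
          ((Function.support_smul_subset_left φ g).trans (subset_tsupport _))).1
            this).integrableOn
      rw [integral_sub h1 (g := fun x => φ x • fderiv ℝ u₁ x (stdE i))
        (((hφ.continuous.smul hcd).integrable_of_hasCompactSupport
        hφc.smul_right).integrableOn), sub_eq_zero]
      exact neg_injective ((h φ hφ hφc hφs).symm.trans (hcl φ hφ hφc hφs)))
  rw [Filter.EventuallyEq, ae_restrict_iff' hU.measurableSet]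
  filter_upwards [this] with x hx hxU
  exact sub_eq_zero.1 (hx hxU)

/-- If all integrals over `U` of derivatives of test functions in an open convex set `B` vanish,
then `B` does not meet both `U` and the exterior of `U`: moving a bump function
from one to the other inside `B` does not change its integral over `U`. -/
theorem not_exterior_of_integral_fderiv_eq_zero {U B W : Set E2} (hU : IsOpen U)
    (hUfin : volume U ≠ ⊤) (hB : IsOpen B) (hBc : Convex ℝ B)
    (h : ∀ ψ : E2 → ℝ, ContDiff ℝ (⊤ : ℕ∞) ψ → HasCompactSupport ψ → tsupport ψ ⊆ B →
      ∀ v, ∫ x in U, fderiv ℝ ψ x v = 0)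
    (hUB : (U ∩ B).Nonempty) (hW : IsOpen W) (hWne : W.Nonempty) (hWB : W ⊆ B)
    (hWU : Disjoint W U) : False := by
  obtain ⟨p, hp⟩ := hUB
  obtain ⟨q, hq⟩ := hWne
  obtain ⟨δ₁, hδ₁, hp₁⟩ := Metric.nhds_basis_closedBall.mem_iff.1 ((hU.inter hB).mem_nhds hp)
  obtain ⟨δ₂, hδ₂, hq₁⟩ := Metric.nhds_basis_closedBall.mem_iff.1 (hW.mem_nhds hq)
  set δ := min δ₁ δ₂
  have hδ : 0 < δ := lt_min hδ₁ hδ₂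
  let b : ContDiffBump (0 : E2) := ⟨δ / 2, δ, by positivity, by linarith⟩
  have hbs : ContDiff ℝ (⊤ : ℕ∞) b := b.contDiff
  have hb1 : ContDiff ℝ 1 b := b.contDiff
  -- the centre of the moving bump
  let c : ℝ → E2 := fun t => p + t • (q - p)
  have hfin : IsFiniteMeasure (volume.restrict U) := ⟨by simpa using hUfin.lt_top⟩
  have htr : ∀ t x, HasFDerivAt (fun x => b (x - c t)) (fderiv ℝ b (x - c t)) x := by
    intro t x
    have := ((hb1.differentiable one_ne_zero) (x - c t)).hasFDerivAt.comp x
      ((hasFDerivAt_id x).sub_const (c t))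
    simpa [Function.comp_def] using this
  obtain ⟨M, hM⟩ := (b.hasCompactSupport.fderiv ℝ).exists_bound_of_continuous
    (hb1.continuous_fderiv one_ne_zero)
  have hcontb : ∀ t, Continuous fun x => b (x - c t) := fun t =>
    b.continuous.comp (continuous_id.sub continuous_const)
  have hcompb : ∀ t, HasCompactSupport fun x => b (x - c t) := fun t =>
    b.hasCompactSupport.comp_homeomorph (Homeomorph.subRight (c t))
  have hderiv : ∀ t, HasDerivAt (fun t => ∫ x in U, b (x - c t))
      (∫ x in U, -(fderiv ℝ b (x - c t) (q - p))) t := by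
    intro t
    refine (hasDerivAt_integral_of_dominated_loc_of_deriv_le
      (F' := fun t x => -(fderiv ℝ b (x - c t) (q - p))) (bound := fun _ => M * ‖q - p‖)
      univ_mem (Eventually.of_forall fun s => (hcontb s).aestronglyMeasurable)
      ((hcontb t).integrable_of_hasCompactSupport (hcompb t)).integrableOn ?_ ?_
      (integrable_const _) ?_).2
    · have := hb1.continuous_fderiv one_ne_zero
      exact Continuous.aestronglyMeasurable (by fun_prop)
    · refine Eventually.of_forall fun x s _ => ?_
      rw [norm_neg]
      exact (fderiv ℝ b (x - c s)).le_of_opNorm_le (hM _) _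
    · refine Eventually.of_forall fun x s _ => ?_
      have hc : HasDerivAt (fun s => x - c s) (-(q - p)) s := by
        have := (((hasDerivAt_id s).smul_const (q - p)).const_add p).const_sub x
        simpa [c] using this
      have := ((hb1.differentiable one_ne_zero) (x - c s)).hasFDerivAt.comp_hasDerivAt s hc
      simpa [Function.comp_def] using this
  have hzero : ∀ t ∈ Icc (0 : ℝ) 1, ∫ x in U, -(fderiv ℝ b (x - c t) (q - p)) = 0 := by
    intro t ht
    rw [integral_neg, neg_eq_zero]
    have hsub : tsupport (fun x => b (x - c t)) ⊆ B := by
      have : tsupport (fun x => b (x - c t)) ⊆ Metric.closedBall (c t) δ := by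
        apply closure_minimal _ Metric.isClosed_closedBall
        intro x hx
        have : x - c t ∈ Function.support b := hx
        rw [b.support_eq] at this
        simpa [dist_eq_norm, b] using (mem_ball_zero_iff.1 this).le
      refine this.trans fun x hx => ?_
      have hx' : ‖x - c t‖ ≤ δ := by simpa [dist_eq_norm] using hx
      have h1 : p + (x - c t) ∈ B := (hp₁ (by
        simpa [dist_eq_norm] using hx'.trans (min_le_left _ _))).2
      have h2 : q + (x - c t) ∈ B := hWB (hq₁ (by
        simpa [dist_eq_norm] using hx'.trans (min_le_right _ _)))
      have := hBc h1 h2 (sub_nonneg.2 ht.2) ht.1 (by ring)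
      convert this using 1
      simp only [c]
      module
    have := h (fun x => b (x - c t)) (hbs.comp (contDiff_id.sub contDiff_const)) (hcompb t) hsub
      (q - p)
    simpa only [(htr t _).fderiv] using this
  have hconst : ∫ x in U, b (x - c 1) = ∫ x in U, b (x - c 0) :=
    constant_of_has_deriv_right_zero (a := 0) (b := 1)
      (fun t _ => (hderiv t).continuousAt.continuousWithinAt)
      (fun t ht => by
        have := (hderiv t).hasDerivWithinAt (s := Ici t)
        rwa [hzero t ⟨ht.1, ht.2.le⟩] at this) 1 ⟨zero_le_one, le_rfl⟩
  have h1 : ∫ x in U, b (x - c 1) = 0 := by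
    apply setIntegral_eq_zero_of_forall_eq_zero
    intro x hx
    apply b.zero_of_le_dist
    by_contra! hlt
    refine hWU.le_bot ⟨hq₁ ?_, hx⟩
    have : ‖x - q‖ < δ := by simpa [c, b] using hlt
    simpa [dist_eq_norm] using this.le.trans (min_le_right _ _)
  have h0 : 0 < ∫ x in U, b (x - c 0) := by
    rw [setIntegral_pos_iff_support_of_nonneg_ae (Eventually.of_forall fun x => b.nonneg)
      ((hcontb 0).integrable_of_hasCompactSupport (hcompb 0)).integrableOn]
    refine (Metric.measure_ball_pos volume p hδ).trans_le (measure_mono fun x hx => ?_)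
    have hx' : ‖x - p‖ < δ := by simpa [dist_eq_norm] using hx
    refine ⟨?_, (hp₁ ?_).1⟩
    · change x - c 0 ∈ Function.support b
      rw [b.support_eq]
      simpa [c, b] using hx'
    · simpa [dist_eq_norm] using hx'.le.trans (min_le_left _ _)
  linarith

/-! ### The jump condition -/

/-- A weak derivative of a piecewise `C¹` map is the piecewise classical derivative. -/
theorem ae_eq_piecewise_fderiv {Ω U₁ U₂ : Set E2} (hΩ : IsOpen Ω) (h₁ : IsOpen U₁) (h₂ : IsOpen U₂)
    (hs₁ : U₁ ⊆ Ω) (hs₂ : U₂ ⊆ Ω) (hd : Disjoint U₁ U₂)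
    (hnull : volume (Ω \ (U₁ ∪ U₂)) = 0) {u g u₁ u₂ : E2 → E3}
    (hu₁ : ContDiff ℝ 1 u₁) (hu₂ : ContDiff ℝ 1 u₂)
    (hu : u =ᵐ[volume.restrict Ω] fun x => U₁.indicator u₁ x + U₂.indicator u₂ x) {i : Fin 2}
    (hg : LocallyIntegrableOn g Ω) (h : IsWeakPartial Ω i u g) :
    g =ᵐ[volume.restrict Ω] fun x => U₁.indicator (fun x => fderiv ℝ u₁ x (stdE i)) x +
      U₂.indicator (fun x => fderiv ℝ u₂ x (stdE i)) x := by
  have e₁ : u =ᵐ[volume.restrict U₁] u₁ := by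
    filter_upwards [ae_restrict_of_ae_restrict_of_subset hs₁ hu,
      self_mem_ae_restrict h₁.measurableSet] with x hx hxU
    have : x ∉ U₂ := fun h => hd.le_bot ⟨hxU, h⟩
    simpa [hxU, this] using hx
  have e₂ : u =ᵐ[volume.restrict U₂] u₂ := by
    filter_upwards [ae_restrict_of_ae_restrict_of_subset hs₂ hu,
      self_mem_ae_restrict h₂.measurableSet] with x hx hxU
    have : x ∉ U₁ := fun h => hd.le_bot ⟨h, hxU⟩
    simpa [hxU, this] using hx
  have g₁ := (h.mono hs₁).ae_eq_fderiv h₁ hu₁ e₁ (hg.mono_set hs₁)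
  have g₂ := (h.mono hs₂).ae_eq_fderiv h₂ hu₂ e₂ (hg.mono_set hs₂)
  rw [Filter.EventuallyEq, ae_restrict_iff' h₁.measurableSet] at g₁
  rw [Filter.EventuallyEq, ae_restrict_iff' h₂.measurableSet] at g₂
  have hn : ∀ᵐ x, x ∈ Ω → x ∈ U₁ ∪ U₂ := by
    filter_upwards [compl_mem_ae_iff.2 hnull] with x hx hxΩ
    by_contra hcon
    exact hx ⟨hxΩ, hcon⟩
  rw [Filter.EventuallyEq, ae_restrict_iff' hΩ.measurableSet]
  filter_upwards [g₁, g₂, hn] with x hx₁ hx₂ hx hxΩ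
  rcases hx hxΩ with hxU | hxU
  · have : x ∉ U₂ := fun h => hd.le_bot ⟨hxU, h⟩
    simp [hxU, this, hx₁]
  · have : x ∉ U₁ := fun h => hd.le_bot ⟨h, hxU⟩
    simp [hxU, this, hx₂]

/-- If a piecewise smooth map is weakly differentiable, then it has no jump. Otherwise the
divergence theorem on `U₁`, applied to test functions divided by a component of the jump, would
make all integrals over `U₁` of derivatives of test functions near some point of the interface
vanish, so one of the two sets would be negligible near that point; a Lipschitz set
has no slits, so this is impossible. -/
theorem eq_of_isWeakPartial_piecewise {Ω U₁ U₂ : Set E2} (hΩ : IsOpen Ω)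
    (hfin : volume Ω ≠ ⊤) (h₁ : IsLipschitzOpen U₁) (h₂ : IsLipschitzOpen U₂)
    (hs₁ : U₁ ⊆ Ω) (hs₂ : U₂ ⊆ Ω) (hd : Disjoint U₁ U₂)
    (hnull : volume (Ω \ (U₁ ∪ U₂)) = 0) {u : E2 → E3} {g : Fin 2 → E2 → E3} {u₁ u₂ : E2 → E3}
    (hu₁ : ContDiff ℝ (⊤ : ℕ∞) u₁) (hu₂ : ContDiff ℝ (⊤ : ℕ∞) u₂)
    (hu : u =ᵐ[volume.restrict Ω] fun x => U₁.indicator u₁ x + U₂.indicator u₂ x)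
    (hg : ∀ i, LocallyIntegrableOn (g i) Ω) (h : ∀ i, IsWeakPartial Ω i u (g i))
    {q : E2} (hq : q ∈ Ω) (hq₁ : q ∉ U₁) (hq₂ : q ∉ U₂) : u₁ q = u₂ q := by
  have hu₁' : ContDiff ℝ 1 u₁ := hu₁.of_le (by exact_mod_cast le_top)
  have hu₂' : ContDiff ℝ 1 u₂ := hu₂.of_le (by exact_mod_cast le_top)
  have hw' : ContDiff ℝ 1 (fun x => u₁ x - u₂ x) := hu₁'.sub hu₂'
  -- the divergence theorem on `U₁` for the jump
  have hjump : ∀ φ : E2 → ℝ, ContDiff ℝ (⊤ : ℕ∞) φ → HasCompactSupport φ → tsupport φ ⊆ Ω →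
      ∀ i, ∫ x in U₁, fderiv ℝ (fun x => φ x • (u₁ x - u₂ x)) x (stdE i) = 0 := by
    intro φ hφ hφc hφs i
    have hφ1 : ContDiff ℝ 1 φ := hφ.of_le (by exact_mod_cast le_top)
    have hae := ae_eq_piecewise_fderiv hΩ h₁.1 h₂.1 hs₁ hs₂ hd hnull hu₁' hu₂' hu (hg i) (h i)
    have hparts := h i φ hφ hφc hφs
    rw [setIntegral_smul_piecewise h₁.1 h₂.1 hs₁ hs₂ hu₁'.continuous hu₂'.continuous hu
        ((hφ1.continuous_fderiv one_ne_zero).clm_apply continuous_const)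
        (hφc.fderiv_apply ℝ (stdE i)),
      setIntegral_smul_piecewise h₁.1 h₂.1 hs₁ hs₂
        ((hu₁'.continuous_fderiv one_ne_zero).clm_apply continuous_const)
        ((hu₂'.continuous_fderiv one_ne_zero).clm_apply continuous_const) hae hφ1.continuous hφc,
      eq_neg_iff_add_eq_zero] at hparts
    -- the same identity for `u₂` on both sides
    have hcl := integral_fderiv_smul_add_eq_zero h₁.1 h₂.1 hd hnull hu₂' hu₂'
      (fun _ _ _ _ => rfl) hφ hφc hφs (stdE i)
    rw [setIntegral_fderiv_smul hφ hφc hu₂', setIntegral_fderiv_smul hφ hφc hu₂'] at hcl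
    have hsub : ∫ x in U₁, fderiv ℝ (fun x => φ x • (u₁ x - u₂ x)) x (stdE i) =
        (∫ x in U₁, fderiv ℝ (fun x => φ x • u₁ x) x (stdE i)) -
          ∫ x in U₁, fderiv ℝ (fun x => φ x • u₂ x) x (stdE i) := by
      have hi : ∀ {u : E2 → E3}, ContDiff ℝ 1 u →
          Integrable (fun x => fderiv ℝ (fun x => φ x • u x) x (stdE i)) := fun {u} hu =>
        (((hφ1.smul hu).continuous_fderiv one_ne_zero).clm_apply
          continuous_const).integrable_of_hasCompactSupport
          ((hφc.smul_right (f' := u)).fderiv_apply ℝ (stdE i))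
      rw [← integral_sub (hi hu₁').integrableOn (hi hu₂').integrableOn]
      congr 1
      ext1 x
      simp only [smul_sub]
      rw [fderiv_fun_sub (f := fun x => φ x • u₁ x) (g := fun x => φ x • u₂ x)
        ((hφ1.smul hu₁').differentiable one_ne_zero x)
        ((hφ1.smul hu₂').differentiable one_ne_zero x)]
      rfl
    rw [hsub, setIntegral_fderiv_smul hφ hφc hu₁', setIntegral_fderiv_smul hφ hφc hu₂']
    have := hparts.trans hcl.symm
    rw [sub_eq_zero]
    refine add_right_cancel (b := (∫ x in U₂, fderiv ℝ φ x (stdE i) • u₂ x) +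
      ∫ x in U₂, φ x • fderiv ℝ u₂ x (stdE i)) ?_
    rw [← this]
    abel
  by_contra hne
  obtain ⟨c, hc⟩ : ∃ c, u₁ q c - u₂ q c ≠ 0 := by
    by_contra! hall
    exact hne (by ext c; exact sub_eq_zero.1 (hall c))
  -- a component of the jump which does not vanish at `q`
  let f : E2 → ℝ := fun x => u₁ x c - u₂ x c
  have hf : ContDiff ℝ (⊤ : ℕ∞) f :=
    ((EuclideanSpace.proj c : E3 →L[ℝ] ℝ).contDiff.comp hu₁).sub
      ((EuclideanSpace.proj c : E3 →L[ℝ] ℝ).contDiff.comp hu₂)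
  obtain ⟨ε, hε, hball⟩ := Metric.isOpen_iff.1
    (hΩ.inter (isOpen_ne_fun hf.continuous continuous_const)) q ⟨hq, hc⟩
  set B := Metric.ball q ε
  have hqB : q ∈ B := Metric.mem_ball_self hε
  -- dividing by the jump
  have htest : ∀ ψ : E2 → ℝ, ContDiff ℝ (⊤ : ℕ∞) ψ → HasCompactSupport ψ → tsupport ψ ⊆ B →
      ∀ v, ∫ x in U₁, fderiv ℝ ψ x v = 0 := by
    intro ψ hψ hψc hψs v
    have hψ1 : ContDiff ℝ 1 ψ := hψ.of_le (by exact_mod_cast le_top)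
    let φ : E2 → ℝ := fun x => ψ x * (f x)⁻¹
    have hφs : tsupport φ ⊆ tsupport ψ := tsupport_mul_subset_left
    have hφ : ContDiff ℝ (⊤ : ℕ∞) φ := by
      refine contDiff_iff_contDiffAt.2 fun x => ?_
      by_cases hx : x ∈ tsupport ψ
      · exact hψ.contDiffAt.mul (hf.contDiffAt.inv (hball (hψs hx)).2)
      · refine (contDiffAt_const (c := (0 : ℝ))).congr_of_eventuallyEq ?_
        filter_upwards [(isClosed_tsupport ψ).isOpen_compl.mem_nhds hx] with z hz
        simp [φ, image_eq_zero_of_notMem_tsupport hz]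
    have hφc : HasCompactSupport φ := hψc.mul_right
    have hφf : ∀ x, φ x * f x = ψ x := by
      intro x
      by_cases hx : x ∈ tsupport ψ
      · exact inv_mul_cancel_right₀ (hball (hψs hx)).2 _
      · simp [φ, image_eq_zero_of_notMem_tsupport hx]
    have hφ1 : ContDiff ℝ 1 φ := hφ.of_le (by exact_mod_cast le_top)
    have hi : ∀ v, Integrable (fun x => fderiv ℝ ψ x v) := fun v =>
      ((hψ1.continuous_fderiv one_ne_zero).clm_apply
        continuous_const).integrable_of_hasCompactSupport (hψc.fderiv_apply ℝ v)
    have hbasis : ∀ i, ∫ x in U₁, fderiv ℝ ψ x (stdE i) = 0 := by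
      intro i
      have h0 := hjump φ hφ hφc (hφs.trans (hψs.trans fun x hx => (hball hx).1)) i
      have hint : Integrable (fun x => fderiv ℝ (fun x => φ x • (u₁ x - u₂ x)) x (stdE i)) :=
        (((hφ1.smul hw').continuous_fderiv one_ne_zero).clm_apply
          continuous_const).integrable_of_hasCompactSupport
          ((hφc.smul_right (f' := fun x => u₁ x - u₂ x)).fderiv_apply ℝ (stdE i))
      have h1 := (EuclideanSpace.proj c : E3 →L[ℝ] ℝ).integral_comp_comm
        (hint.integrableOn (s := U₁))
      rw [h0, map_zero] at h1
      rw [← h1]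
      congr 1
      ext1 x
      have := ((EuclideanSpace.proj c : E3 →L[ℝ] ℝ).hasFDerivAt.comp x
        ((hφ1.smul hw').differentiable one_ne_zero x).hasFDerivAt).fderiv
      refine Eq.trans ?_ (congrArg (fun L : E2 →L[ℝ] ℝ => L (stdE i)) this)
      congr 2
      ext1 z
      exact (hφf z).symm
    have hv : v = v 0 • stdE 0 + v 1 • stdE 1 := by
      ext j
      fin_cases j <;> simp [stdE]
    rw [hv]
    simp only [map_add, map_smul, smul_eq_mul]
    rw [integral_add ((hi _).const_mul _).integrableOn ((hi _).const_mul _).integrableOn,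
      integral_const_mul, integral_const_mul, hbasis 0, hbasis 1]
    simp
  have hfin₁ : volume U₁ ≠ ⊤ := ((measure_mono hs₁).trans_lt hfin.lt_top).ne
  have hBconv : Convex ℝ B := convex_ball q ε
  have hBΩ : B ⊆ Ω := fun x hx => (hball hx).1
  -- a nonempty open subset of `B` meets one of the two open sets
  have hmeet : ∀ W : Set E2, IsOpen W → W.Nonempty → W ⊆ B → Disjoint W U₁ → Disjoint W U₂ →
      False := by
    intro W hW hWne hWB hW₁ hW₂
    have : W ⊆ Ω \ (U₁ ∪ U₂) := fun x hx => ⟨hBΩ (hWB hx), fun h =>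
      h.elim (fun h => hW₁.le_bot ⟨hx, h⟩) (fun h => hW₂.le_bot ⟨hx, h⟩)⟩
    exact (hW.measure_pos volume hWne).ne' (measure_mono_null this hnull)
  by_cases hm : (U₁ ∩ B).Nonempty
  · by_cases hm₂ : (U₂ ∩ B).Nonempty
    · exact not_exterior_of_integral_fderiv_eq_zero h₁.1 hfin₁ Metric.isOpen_ball hBconv htest hm
        (h₂.1.inter Metric.isOpen_ball) hm₂ inter_subset_right
        (hd.symm.mono_left inter_subset_left)
    -- `U₂` is absent from `B`, so `q` would be a slit of `U₁`
    · have hqf : q ∈ frontier U₁ := by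
        rw [h₁.1.frontier_eq]
        refine ⟨?_, hq₁⟩
        by_contra hcl
        refine hmeet ((closure U₁)ᶜ ∩ B) (isClosed_closure.isOpen_compl.inter Metric.isOpen_ball)
          ⟨q, hcl, hqB⟩ inter_subset_right
          (Set.disjoint_left.2 fun x hx hx' => hx.1 (subset_closure hx'))
          (Set.disjoint_left.2 fun x hx hx' => hm₂ ⟨x, hx', hx.2⟩)
      obtain ⟨W, hW, hWne, hWB, hW₁⟩ := h₁.exists_isOpen_exterior hqf Metric.isOpen_ball hqB
      exact hmeet W hW hWne hWB hW₁ (Set.disjoint_left.2 fun x hx hx' => hm₂ ⟨x, hx', hWB hx⟩)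
  -- symmetric, with the roles of the two sets exchanged
  · have hqf : q ∈ frontier U₂ := by
      rw [h₂.1.frontier_eq]
      refine ⟨?_, hq₂⟩
      by_contra hcl
      refine hmeet ((closure U₂)ᶜ ∩ B) (isClosed_closure.isOpen_compl.inter Metric.isOpen_ball)
        ⟨q, hcl, hqB⟩ inter_subset_right
        (Set.disjoint_left.2 fun x hx hx' => hm ⟨x, hx', hx.2⟩)
        (Set.disjoint_left.2 fun x hx hx' => hx.1 (subset_closure hx'))
    obtain ⟨W, hW, hWne, hWB, hW₂⟩ := h₂.exists_isOpen_exterior hqf Metric.isOpen_ball hqB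
    exact hmeet W hW hWne hWB (Set.disjoint_left.2 fun x hx hx' => hm ⟨x, hx', hWB hx⟩) hW₂

/-! ### Derivatives of cylinder maps -/

/-- The `i`-th partial derivative of the cylinder `cyl v R r ρ`: the second and third columns of
`R * rotZ θ` are the unit tangents along the directrix and along the ruling. -/
noncomputable def cylD (R : Matrix (Fin 3) (Fin 3) ℝ) (r : ℝ) (ρ : Matrix (Fin 2) (Fin 2) ℝ)
    (i : Fin 2) (x : E2) : E3 :=
  (R * rotZ (angleAt r ρ x)).toEuclideanLin !₂[0, ρ 0 i, ρ 1 i]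

theorem toEuclideanLin_two_apply (ρ : Matrix (Fin 2) (Fin 2) ℝ) (x : E2) (j : Fin 2) :
    ρ.toEuclideanLin x j = ρ j 0 * x 0 + ρ j 1 * x 1 := by
  simp only [Matrix.toLpLin_apply, Matrix.mulVec, dotProduct, Fin.sum_univ_two]

theorem toEuclideanLin_three_apply (R : Matrix (Fin 3) (Fin 3) ℝ) (x : E3) (j : Fin 3) :
    R.toEuclideanLin x j = R j 0 * x 0 + R j 1 * x 1 + R j 2 * x 2 := by
  simp only [Matrix.toLpLin_apply, Matrix.mulVec, dotProduct, Fin.sum_univ_three]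

theorem angleAt_eq (r : ℝ) (ρ : Matrix (Fin 2) (Fin 2) ℝ) (x : E2) :
    angleAt r ρ x = (ρ 0 0 * x 0 + ρ 0 1 * x 1) / r := by
  rw [angleAt, toEuclideanLin_two_apply]

theorem ruling_apply (ρ : Matrix (Fin 2) (Fin 2) ℝ) (j : Fin 2) : ruling ρ j = ρ 1 j := by
  rw [ruling, toEuclideanLin_two_apply]
  simp [stdE]

theorem cyl_apply (v : E3) (R : Matrix (Fin 3) (Fin 3) ℝ) (r : ℝ) (ρ : Matrix (Fin 2) (Fin 2) ℝ)
    (x : E2) (j : Fin 3) :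
    cyl v R r ρ x j = v j + (R j 0 * (r * (Real.cos (angleAt r ρ x) - 1)) +
      R j 1 * (r * Real.sin (angleAt r ρ x)) + R j 2 * (ρ 1 0 * x 0 + ρ 1 1 * x 1)) := by
  rw [cyl, PiLp.add_apply, toEuclideanLin_three_apply, ← toEuclideanLin_two_apply]
  simp [stdCyl, angleAt]

theorem cylD_apply (R : Matrix (Fin 3) (Fin 3) ℝ) (r : ℝ) (ρ : Matrix (Fin 2) (Fin 2) ℝ)
    (i : Fin 2) (x : E2) (j : Fin 3) :
    cylD R r ρ i x j = R j 0 * (-Real.sin (angleAt r ρ x) * ρ 0 i) +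
      R j 1 * (Real.cos (angleAt r ρ x) * ρ 0 i) + R j 2 * ρ 1 i := by
  rw [cylD, toEuclideanLin_three_apply]
  simp [Matrix.mul_apply, Fin.sum_univ_three, rotZ]
  ring

theorem contDiff_angleAt (r : ℝ) (ρ : Matrix (Fin 2) (Fin 2) ℝ) :
    ContDiff ℝ (⊤ : ℕ∞) (angleAt r ρ) := by
  have : angleAt r ρ = fun x => (ρ 0 0 * x 0 + ρ 0 1 * x 1) / r := funext (angleAt_eq r ρ)
  rw [this]
  fun_prop

theorem contDiff_cyl (v : E3) (R : Matrix (Fin 3) (Fin 3) ℝ) (r : ℝ)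
    (ρ : Matrix (Fin 2) (Fin 2) ℝ) : ContDiff ℝ (⊤ : ℕ∞) (cyl v R r ρ) := by
  have := contDiff_angleAt r ρ
  rw [contDiff_euclidean]
  intro j
  simp only [cyl_apply]
  fun_prop

theorem contDiff_cylD (R : Matrix (Fin 3) (Fin 3) ℝ) (r : ℝ) (ρ : Matrix (Fin 2) (Fin 2) ℝ)
    (i : Fin 2) : ContDiff ℝ (⊤ : ℕ∞) (cylD R r ρ i) := by
  have := contDiff_angleAt r ρ
  rw [contDiff_euclidean]
  intro j
  simp only [cylD_apply]
  fun_prop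

theorem fderiv_cyl (v : E3) (R : Matrix (Fin 3) (Fin 3) ℝ) {r : ℝ} (hr : r ≠ 0)
    (ρ : Matrix (Fin 2) (Fin 2) ℝ) (i : Fin 2) (x : E2) :
    fderiv ℝ (cyl v R r ρ) x (stdE i) = cylD R r ρ i x := by
  have hdiff : DifferentiableAt ℝ (cyl v R r ρ) x :=
    (contDiff_cyl v R r ρ).differentiable (by simp) x
  have hline : HasDerivAt (fun t : ℝ => cyl v R r ρ (x + t • stdE i))
      (fderiv ℝ (cyl v R r ρ) x (stdE i)) 0 := hdiff.hasFDerivAt.hasLineDerivAt (stdE i)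
  have ha : ∀ t : ℝ, angleAt r ρ (x + t • stdE i) = angleAt r ρ x + t * (ρ 0 i / r) := by
    intro t
    rw [angleAt_eq, angleAt_eq]
    fin_cases i <;> simp [stdE] <;> ring
  have hb : ∀ t : ℝ, ρ 1 0 * (x + t • stdE i) 0 + ρ 1 1 * (x + t • stdE i) 1 =
      ρ 1 0 * x 0 + ρ 1 1 * x 1 + t * ρ 1 i := by
    intro t
    fin_cases i <;> simp [stdE] <;> ring
  ext j
  have hj : HasDerivAt (fun t : ℝ => cyl v R r ρ (x + t • stdE i) j)
      (fderiv ℝ (cyl v R r ρ) x (stdE i) j) 0 :=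
    (EuclideanSpace.proj j : E3 →L[ℝ] ℝ).hasFDerivAt.comp_hasDerivAt (0 : ℝ) hline
  refine hj.unique ?_
  simp only [cyl_apply, ha, hb, cylD_apply]
  have hθ : HasDerivAt (fun t : ℝ => angleAt r ρ x + t * (ρ 0 i / r)) (ρ 0 i / r) 0 := by
    simpa using ((hasDerivAt_id (0 : ℝ)).mul_const (ρ 0 i / r)).const_add (angleAt r ρ x)
  have hz : HasDerivAt (fun t : ℝ => ρ 1 0 * x 0 + ρ 1 1 * x 1 + t * ρ 1 i) (ρ 1 i) 0 := by
    simpa using ((hasDerivAt_id (0 : ℝ)).mul_const (ρ 1 i)).const_add (ρ 1 0 * x 0 + ρ 1 1 * x 1)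
  have := ((((hθ.cos.sub_const 1).const_mul r).const_mul (R j 0)).add
    ((hθ.sin.const_mul r).const_mul (R j 1))).add (hz.const_mul (R j 2)) |>.const_add (v j)
  rw [zero_mul, add_zero] at this
  refine this.congr_deriv ?_
  field_simp

theorem inner_toEuclideanLin_of_orthogonal {M : Matrix (Fin 3) (Fin 3) ℝ}
    (hM : M ∈ Matrix.orthogonalGroup (Fin 3) ℝ) (a b : E3) :
    inner ℝ (M.toEuclideanLin a) (M.toEuclideanLin b) = inner ℝ a b := by
  have h := (Matrix.mem_orthogonalGroup_iff' (Fin 3) ℝ).1 hM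
  have h' : M.transpose * M = 1 := h
  simp only [EuclideanSpace.inner_eq_star_dotProduct, Matrix.ofLp_toLpLin, star_trivial,
    Matrix.toLin'_apply]
  rw [Matrix.dotProduct_mulVec, Matrix.vecMul_mulVec, h', Matrix.vecMul_one]

theorem rotZ_mem (θ : ℝ) : rotZ θ ∈ Matrix.specialOrthogonalGroup (Fin 3) ℝ := by
  rw [Matrix.mem_specialOrthogonalGroup_iff, Matrix.mem_orthogonalGroup_iff]
  have := Real.sin_sq_add_cos_sq θ
  constructor
  · ext i j
    fin_cases i <;> fin_cases j <;>
      simp [rotZ, Matrix.mul_apply, Fin.sum_univ_three] <;> linarith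
  · rw [Matrix.det_fin_three]
    simp [rotZ]
    linarith

theorem inner_cylD {R : Matrix (Fin 3) (Fin 3) ℝ}
    (hR : R ∈ Matrix.specialOrthogonalGroup (Fin 3) ℝ) (r : ℝ) {ρ : Matrix (Fin 2) (Fin 2) ℝ}
    (hρ : ρ ∈ Matrix.orthogonalGroup (Fin 2) ℝ) (i j : Fin 2) (x : E2) :
    inner ℝ (cylD R r ρ i x) (cylD R r ρ j x) = if i = j then 1 else 0 := by
  have h := (Matrix.mem_orthogonalGroup_iff' (Fin 2) ℝ).1 hρ
  rw [cylD, cylD, inner_toEuclideanLin_of_orthogonal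
    (Matrix.mem_specialOrthogonalGroup_iff.1 (mul_mem hR (rotZ_mem _))).1]
  have hij := congrFun (congrFun h j) i
  simp only [Matrix.mul_apply, Fin.sum_univ_two, Matrix.one_apply] at hij
  simp only [EuclideanSpace.inner_eq_star_dotProduct, star_trivial, dotProduct,
    Fin.sum_univ_three]
  simpa [eq_comm] using hij

theorem norm_cylD {R : Matrix (Fin 3) (Fin 3) ℝ}
    (hR : R ∈ Matrix.specialOrthogonalGroup (Fin 3) ℝ) (r : ℝ) {ρ : Matrix (Fin 2) (Fin 2) ℝ}
    (hρ : ρ ∈ Matrix.orthogonalGroup (Fin 2) ℝ) (i : Fin 2) (x : E2) :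
    ‖cylD R r ρ i x‖ = 1 := by
  have := inner_cylD hR r hρ i i x
  rw [real_inner_self_eq_norm_sq, if_pos rfl] at this
  exact (pow_eq_one_iff_of_nonneg (norm_nonneg _) two_ne_zero).1 this

/-! ### Matching two cylinders at first order -/

theorem transpose_mul_self_of_mem {M : Matrix (Fin 3) (Fin 3) ℝ}
    (hM : M ∈ Matrix.specialOrthogonalGroup (Fin 3) ℝ) : M.transpose * M = 1 :=
  (Matrix.mem_orthogonalGroup_iff' (Fin 3) ℝ).1 (Matrix.mem_specialOrthogonalGroup_iff.1 hM).1

theorem self_mul_transpose_of_mem {M : Matrix (Fin 3) (Fin 3) ℝ}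
    (hM : M ∈ Matrix.specialOrthogonalGroup (Fin 3) ℝ) : M * M.transpose = 1 :=
  (Matrix.mem_orthogonalGroup_iff (Fin 3) ℝ).1 (Matrix.mem_specialOrthogonalGroup_iff.1 hM).1

theorem transpose_mem {M : Matrix (Fin 3) (Fin 3) ℝ}
    (hM : M ∈ Matrix.specialOrthogonalGroup (Fin 3) ℝ) :
    M.transpose ∈ Matrix.specialOrthogonalGroup (Fin 3) ℝ := by
  rw [Matrix.mem_specialOrthogonalGroup_iff, Matrix.det_transpose]
  exact ⟨(Matrix.mem_orthogonalGroup_iff (Fin 3) ℝ).2 (transpose_mul_self_of_mem hM),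
    (Matrix.mem_specialOrthogonalGroup_iff.1 hM).2⟩

/-- The matrix `diag(det P, P)`, the rotation of space which extends the planar orthogonal map `P`
of the second and third coordinates. -/
noncomputable def blockDet (P : Matrix (Fin 2) (Fin 2) ℝ) : Matrix (Fin 3) (Fin 3) ℝ :=
  !![P.det, 0, 0; 0, P 0 0, P 0 1; 0, P 1 0, P 1 1]

theorem blockDet_diagonal (σ₁ σ₂ : ℝ) :
    blockDet (Matrix.diagonal ![σ₁, σ₂]) = Matrix.diagonal ![σ₁ * σ₂, σ₁, σ₂] := by
  ext i j
  fin_cases i <;> fin_cases j <;> simp [blockDet]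

/-- The first column of a rotation is the cross product of the other two. -/
theorem eq_blockDet_of_mem {Q : Matrix (Fin 3) (Fin 3) ℝ}
    (hQ : Q ∈ Matrix.specialOrthogonalGroup (Fin 3) ℝ) {P : Matrix (Fin 2) (Fin 2) ℝ}
    (h01 : Q 0 1 = 0) (h02 : Q 0 2 = 0) (h11 : Q 1 1 = P 0 0) (h12 : Q 1 2 = P 0 1)
    (h21 : Q 2 1 = P 1 0) (h22 : Q 2 2 = P 1 1) : Q = blockDet P := by
  have hadj : Q.adjugate = Q.transpose := by
    calc Q.adjugate = Q.adjugate * (Q * Q.transpose) := by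
          rw [self_mul_transpose_of_mem hQ, mul_one]
      _ = Q.transpose := by
          rw [← mul_assoc, Matrix.adjugate_mul, (Matrix.mem_specialOrthogonalGroup_iff.1 hQ).2,
            one_smul, one_mul]
  rw [Matrix.adjugate_fin_three] at hadj
  have e00 := congrFun (congrFun hadj 0) 0
  have e01 := congrFun (congrFun hadj 0) 1
  have e02 := congrFun (congrFun hadj 0) 2
  simp [h01, h02, h11, h12, h21, h22] at e00 e01 e02
  ext i j
  fin_cases i <;> fin_cases j <;> (simp [blockDet, Matrix.det_fin_two, *]; try linarith)

theorem mul_rotZ_mem {R : Matrix (Fin 3) (Fin 3) ℝ}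
    (hR : R ∈ Matrix.specialOrthogonalGroup (Fin 3) ℝ) (θ : ℝ) :
    R * rotZ θ ∈ Matrix.specialOrthogonalGroup (Fin 3) ℝ := mul_mem hR (rotZ_mem θ)

theorem mul_transpose_mul_cancel {ρ₁ ρ₂ : Matrix (Fin 2) (Fin 2) ℝ}
    (hρ₂ : ρ₂ ∈ Matrix.orthogonalGroup (Fin 2) ℝ) : ρ₁ * ρ₂.transpose * ρ₂ = ρ₁ := by
  have h : ρ₂.transpose * ρ₂ = 1 := (Matrix.mem_orthogonalGroup_iff' (Fin 2) ℝ).1 hρ₂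
  rw [mul_assoc, h, mul_one]

/-- The gradients of two cylinders agree at a point exactly when their moving frames there
differ by `diag(det P, P)` with `P = ρ₁ ρ₂ᵀ`. -/
theorem cylD_eq_iff {R₁ R₂ : Matrix (Fin 3) (Fin 3) ℝ}
    (hR₁ : R₁ ∈ Matrix.specialOrthogonalGroup (Fin 3) ℝ)
    (hR₂ : R₂ ∈ Matrix.specialOrthogonalGroup (Fin 3) ℝ) {r₁ r₂ : ℝ}
    {ρ₁ ρ₂ : Matrix (Fin 2) (Fin 2) ℝ} (hρ₂ : ρ₂ ∈ Matrix.orthogonalGroup (Fin 2) ℝ) {x : E2} :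
    (∀ i, cylD R₁ r₁ ρ₁ i x = cylD R₂ r₂ ρ₂ i x) ↔
      (R₁ * rotZ (angleAt r₁ ρ₁ x)).transpose * (R₂ * rotZ (angleAt r₂ ρ₂ x)) =
        blockDet (ρ₁ * ρ₂.transpose) := by
  set M₁ := R₁ * rotZ (angleAt r₁ ρ₁ x) with hM₁
  set M₂ := R₂ * rotZ (angleAt r₂ ρ₂ x) with hM₂
  have h₁ := mul_rotZ_mem hR₁ (angleAt r₁ ρ₁ x)
  have h₂ := mul_rotZ_mem hR₂ (angleAt r₂ ρ₂ x)
  rw [← hM₁] at h₁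
  rw [← hM₂] at h₂
  let N : Matrix (Fin 2) (Fin 2) ℝ → Matrix (Fin 3) (Fin 2) ℝ := fun ρ =>
    !![0, 0; ρ 0 0, ρ 0 1; ρ 1 0, ρ 1 1]
  have hN : ∀ (ρ P : Matrix (Fin 2) (Fin 2) ℝ), N ρ * P = N (ρ * P) := by
    intro ρ P
    ext i j
    fin_cases i <;> fin_cases j <;> simp [N, Matrix.mul_apply, Fin.sum_univ_two]
  have hDN : ∀ P ρ : Matrix (Fin 2) (Fin 2) ℝ, blockDet P * N ρ = N (P * ρ) := by
    intro P ρ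
    ext i j
    fin_cases i <;> fin_cases j <;>
      simp [N, blockDet, Matrix.mul_apply, Fin.sum_univ_two, Fin.sum_univ_three]
  have hgrad : (∀ i, cylD R₁ r₁ ρ₁ i x = cylD R₂ r₂ ρ₂ i x) ↔ M₁ * N ρ₁ = M₂ * N ρ₂ := by
    constructor
    · intro h
      ext j i
      have := congrArg (fun w : E3 => w j) (h i)
      simp only [cylD, ← hM₁, ← hM₂, toEuclideanLin_three_apply] at this
      fin_cases i <;> simpa [N, Matrix.mul_apply, Fin.sum_univ_three] using this
    · intro h i
      ext j
      have := congrFun (congrFun h j) i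
      simp only [cylD, ← hM₁, ← hM₂, toEuclideanLin_three_apply]
      fin_cases i <;> simpa [N, Matrix.mul_apply, Fin.sum_univ_three] using this
  rw [hgrad]
  constructor
  · intro h
    have hQN : M₁.transpose * M₂ * N 1 = N (ρ₁ * ρ₂.transpose) := by
      have hρ : ρ₂ * ρ₂.transpose = 1 := (Matrix.mem_orthogonalGroup_iff (Fin 2) ℝ).1 hρ₂
      rw [← hρ, ← hN, ← Matrix.mul_assoc, Matrix.mul_assoc M₁.transpose, ← h,
        ← Matrix.mul_assoc, transpose_mul_self_of_mem h₁, Matrix.one_mul, hN]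
    have e : ∀ i j, _ := fun i j => congrFun (congrFun hQN i) j
    have e00 := e 0 0
    have e10 := e 1 0
    have e20 := e 2 0
    have e01 := e 0 1
    have e11 := e 1 1
    have e21 := e 2 1
    rw [Matrix.mul_apply, Fin.sum_univ_three] at e00 e10 e20 e01 e11 e21
    refine eq_blockDet_of_mem (mul_mem (transpose_mem h₁) h₂) ?_ ?_ ?_ ?_ ?_ ?_
    · simpa [N] using e00
    · simpa [N] using e01
    · simpa [N] using e10
    · simpa [N] using e11
    · simpa [N] using e20
    · simpa [N] using e21
  · intro h
    have hM : M₂ = M₁ * blockDet (ρ₁ * ρ₂.transpose) := by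
      rw [← h, ← mul_assoc, self_mul_transpose_of_mem h₁, one_mul]
    rw [hM, Matrix.mul_assoc M₁, hDN, mul_transpose_mul_cancel hρ₂]

theorem rotZ_add (α β : ℝ) : rotZ (α + β) = rotZ α * rotZ β := by
  ext i j
  fin_cases i <;> fin_cases j <;>
    simp [rotZ, Matrix.mul_apply, Fin.sum_univ_three, Real.cos_add, Real.sin_add] <;> ring

theorem rotZ_transpose (α : ℝ) : (rotZ α).transpose = rotZ (-α) := by
  ext i j
  fin_cases i <;> fin_cases j <;> simp [rotZ]

/-- The frames of two cylinders stay in the same relative position only if the increments of the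
two angles are intertwined. -/
theorem rotZ_mul_comm_of_frames {R₁ R₂ D : Matrix (Fin 3) (Fin 3) ℝ} {a a' b b' : ℝ}
    (h : (R₁ * rotZ a).transpose * (R₂ * rotZ b) = D)
    (h' : (R₁ * rotZ a').transpose * (R₂ * rotZ b') = D) :
    rotZ (a' - a) * D = D * rotZ (b' - b) := by
  have e : ∀ s t, (R₁ * rotZ s).transpose * (R₂ * rotZ t) =
      rotZ (-s) * (R₁.transpose * R₂) * rotZ t := by
    intro s t
    rw [Matrix.transpose_mul, rotZ_transpose]
    simp only [mul_assoc]
  calc rotZ (a' - a) * D = rotZ (a' - a) * (rotZ (-a') * (R₁.transpose * R₂) * rotZ b') := by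
        rw [← h', e]
    _ = rotZ (-a) * (R₁.transpose * R₂) * rotZ b * rotZ (b' - b) := by
        rw [mul_assoc _ (rotZ b), ← rotZ_add, add_sub_cancel, ← mul_assoc, ← mul_assoc,
          ← rotZ_add]
        ring_nf
    _ = D * rotZ (b' - b) := by rw [← h, e]

/-- Matrix coefficients of an intertwining relation: either `P` is not diagonal and both angles are
multiples of `2π`, or `P` is diagonal and the angles agree up to sign modulo `2π`. -/
theorem cos_eq_one_of_rotZ_comm {P : Matrix (Fin 2) (Fin 2) ℝ}
    (hP : P ∈ Matrix.orthogonalGroup (Fin 2) ℝ) {α β : ℝ}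
    (h : rotZ α * blockDet P = blockDet P * rotZ β) :
    (P 0 1 ≠ 0 → Real.cos α = 1 ∧ Real.cos β = 1) ∧
      (P 0 1 = 0 → Real.cos (α - P 1 1 * β) = 1) := by
  have hPP : P * P.transpose = 1 := (Matrix.mem_orthogonalGroup_iff (Fin 2) ℝ).1 hP
  have p00 := congrFun (congrFun hPP 0) 0
  have p11 := congrFun (congrFun hPP 1) 1
  have p01 := congrFun (congrFun hPP 0) 1
  simp [Matrix.mul_apply, Fin.sum_univ_two] at p00 p11 p01
  have hdet : P.det ≠ 0 := by
    intro h0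
    have := congrArg Matrix.det hPP
    simp [h0] at this
  have e00 := congrFun (congrFun h 0) 0
  have e10 := congrFun (congrFun h 1) 0
  have e12 := congrFun (congrFun h 1) 2
  simp [rotZ, blockDet, Matrix.mul_apply, Fin.sum_univ_three] at e00 e10 e12
  rw [mul_comm, mul_right_inj' hdet] at e00
  constructor
  · intro hb
    have h1 : Real.cos α = 1 := by
      exact mul_right_cancel₀ hb (by linarith)
    exact ⟨h1, e00 ▸ h1⟩
  · intro hb
    rw [hb] at p00 p01
    have ha : P 0 0 ≠ 0 := by
      intro h0
      simp [h0] at p00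
    have hc : P 1 0 = 0 := by
      have : P 0 0 * P 1 0 = 0 := by linarith
      exact (mul_eq_zero.1 this).resolve_left ha
    rw [hc] at p11
    have hd : P 1 1 = 1 ∨ P 1 1 = -1 := mul_self_eq_one_iff.1 (by linarith)
    rw [Matrix.det_fin_two, hb, hc] at e10
    have hs : P 1 1 * Real.sin α = Real.sin β := by
      apply mul_left_cancel₀ ha
      linarith
    have h2 := Real.sin_sq_add_cos_sq β
    rcases hd with hd | hd
    · rw [hd] at hs ⊢
      rw [one_mul, Real.cos_sub, e00, ← hs]
      rw [← hs] at h2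
      linarith
    · rw [hd] at hs ⊢
      rw [show α - -1 * β = α + β by ring, Real.cos_add, e00, ← hs]
      rw [← hs] at h2
      linarith

/-! ### Contact along a curve -/

/-- A continuous function with values in `2πℤ` which vanishes at `0` vanishes identically. -/
theorem eq_zero_of_cos_eq_one {f : unitInterval → ℝ} (hf : Continuous f) (h0 : f 0 = 0)
    (h : ∀ t, Real.cos (f t) = 1) (t : unitInterval) : f t = 0 := by
  by_contra hne
  have hpos : 0 < |f t| := abs_pos.2 hne
  have hm : 0 < min |f t| Real.pi := lt_min hpos Real.pi_pos
  obtain ⟨s, -, hs⟩ := isPreconnected_univ.intermediate_value (mem_univ 0) (mem_univ t)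
    hf.abs.continuousOn (show min |f t| Real.pi ∈ Icc |f 0| |f t| from
      ⟨by simpa [h0] using hm.le, min_le_left _ _⟩)
  have hcos : Real.cos (min |f t| Real.pi) = 1 := by
    rw [← hs, Real.cos_abs, h]
  have := (Real.cos_eq_one_iff_of_lt_of_lt (by linarith [Real.pi_pos])
    (by linarith [min_le_right |f t| Real.pi, Real.pi_pos])).1 hcos
  linarith

theorem mul_transpose_mem {ρ₁ ρ₂ : Matrix (Fin 2) (Fin 2) ℝ}
    (hρ₁ : ρ₁ ∈ Matrix.orthogonalGroup (Fin 2) ℝ) (hρ₂ : ρ₂ ∈ Matrix.orthogonalGroup (Fin 2) ℝ) :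
    ρ₁ * ρ₂.transpose ∈ Matrix.orthogonalGroup (Fin 2) ℝ :=
  mul_mem hρ₁ ((Matrix.mem_orthogonalGroup_iff (Fin 2) ℝ).2
    (by
      change ρ₂.transpose * ρ₂.transpose.transpose = 1
      rw [Matrix.transpose_transpose]
      exact (Matrix.mem_orthogonalGroup_iff' (Fin 2) ℝ).1 hρ₂))

theorem exists_eq_diagonal_of_mem {P : Matrix (Fin 2) (Fin 2) ℝ}
    (hP : P ∈ Matrix.orthogonalGroup (Fin 2) ℝ) (h : P 0 1 = 0) :
    ∃ σ₁ σ₂ : ℝ, (σ₁ = 1 ∨ σ₁ = -1) ∧ (σ₂ = 1 ∨ σ₂ = -1) ∧ P = Matrix.diagonal ![σ₁, σ₂] := by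
  have hPP : P * P.transpose = 1 := (Matrix.mem_orthogonalGroup_iff (Fin 2) ℝ).1 hP
  have p00 := congrFun (congrFun hPP 0) 0
  have p11 := congrFun (congrFun hPP 1) 1
  have p01 := congrFun (congrFun hPP 0) 1
  simp [Matrix.mul_apply, Fin.sum_univ_two, h] at p00 p11 p01
  have ha : P 0 0 ≠ 0 := by
    intro h0
    simp [h0] at p00
  have hc : P 1 0 = 0 := p01.resolve_left ha
  rw [hc] at p11
  refine ⟨P 0 0, P 1 1, mul_self_eq_one_iff.1 p00, mul_self_eq_one_iff.1 (by linarith), ?_⟩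
  ext i j
  fin_cases i <;> fin_cases j <;> simp [h, hc]

/-- The lower right entry of `ρ₁ ρ₂ᵀ` is the inner product of the two unit rulings. -/
theorem exists_eq_diagonal_of_isParallel {ρ₁ ρ₂ : Matrix (Fin 2) (Fin 2) ℝ}
    (hρ₁ : ρ₁ ∈ Matrix.orthogonalGroup (Fin 2) ℝ) (hρ₂ : ρ₂ ∈ Matrix.orthogonalGroup (Fin 2) ℝ)
    {e : E2} (h₁ : IsParallel (ruling ρ₁) e) (h₂ : IsParallel (ruling ρ₂) e) :
    ∃ σ₁ σ₂ : ℝ, (σ₁ = 1 ∨ σ₁ = -1) ∧ (σ₂ = 1 ∨ σ₂ = -1) ∧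
      ρ₁ * ρ₂.transpose = Matrix.diagonal ![σ₁, σ₂] := by
  have hP := mul_transpose_mem hρ₁ hρ₂
  refine exists_eq_diagonal_of_mem hP ?_
  obtain ⟨c₁, h₁⟩ := h₁
  obtain ⟨c₂, h₂⟩ := h₂
  have a : ∀ j, ρ₁ 1 j = c₁ * e j := fun j => by
    rw [← ruling_apply ρ₁ j, h₁]
    rfl
  have b : ∀ j, ρ₂ 1 j = c₂ * e j := fun j => by
    rw [← ruling_apply ρ₂ j, h₂]
    rfl
  have r₁ := congrFun (congrFun ((Matrix.mem_orthogonalGroup_iff (Fin 2) ℝ).1 hρ₁) 1) 1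
  have r₂ := congrFun (congrFun ((Matrix.mem_orthogonalGroup_iff (Fin 2) ℝ).1 hρ₂) 1) 1
  have hPP := congrFun (congrFun ((Matrix.mem_orthogonalGroup_iff' (Fin 2) ℝ).1 hP) 1) 1
  have h11 : (ρ₁ * ρ₂.transpose) 1 1 = c₁ * c₂ * (e 0 * e 0 + e 1 * e 1) := by
    simp only [Matrix.mul_apply, Fin.sum_univ_two, Matrix.transpose_apply, a, b]
    ring
  simp [Matrix.mul_apply, Fin.sum_univ_two, a] at r₁
  simp [Matrix.mul_apply, Fin.sum_univ_two, b] at r₂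
  rw [Matrix.mul_apply, Fin.sum_univ_two] at hPP
  simp only [Matrix.one_apply_eq] at hPP
  change (ρ₁ * ρ₂.transpose) 0 1 * (ρ₁ * ρ₂.transpose) 0 1 +
    (ρ₁ * ρ₂.transpose) 1 1 * (ρ₁ * ρ₂.transpose) 1 1 = 1 at hPP
  have hsq : (ρ₁ * ρ₂.transpose) 1 1 * (ρ₁ * ρ₂.transpose) 1 1 = 1 := by
    rw [h11]
    calc _ = (c₁ * e 0 * (c₁ * e 0) + c₁ * e 1 * (c₁ * e 1)) *
        (c₂ * e 0 * (c₂ * e 0) + c₂ * e 1 * (c₂ * e 1)) := by ring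
      _ = 1 := by rw [r₁, r₂, one_mul]
  exact mul_self_eq_zero.1 (by linarith)

/-- A curve along which the moving frames stay in the relative position required for first-order
contact is a common ruling, because the two second fundamental forms differ: equal
radii come with opposite orientations. -/
theorem contact_along_ruling {R₁ R₂ : Matrix (Fin 3) (Fin 3) ℝ} {r₁ r₂ : ℝ} (hr₁ : 0 < r₁)
    (hr₂ : 0 < r₂) {ρ₁ ρ₂ : Matrix (Fin 2) (Fin 2) ℝ}
    (hρ₁ : ρ₁ ∈ Matrix.orthogonalGroup (Fin 2) ℝ) (hρ₂ : ρ₂ ∈ Matrix.orthogonalGroup (Fin 2) ℝ)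
    (hdet : r₁ = r₂ → ρ₁.det = -ρ₂.det) {γ : unitInterval → E2} (hγ : Continuous γ)
    (hinj : Function.Injective γ)
    (h : ∀ t, (R₁ * rotZ (angleAt r₁ ρ₁ (γ t))).transpose * (R₂ * rotZ (angleAt r₂ ρ₂ (γ t))) =
      blockDet (ρ₁ * ρ₂.transpose)) :
    (ρ₁ * ρ₂.transpose) 0 1 = 0 ∧
      ∀ t, angleAt r₂ ρ₂ (γ t) = angleAt r₂ ρ₂ (γ 0) := by
  have hP := mul_transpose_mem hρ₁ hρ₂
  have hPρ := mul_transpose_mul_cancel (ρ₁ := ρ₁) hρ₂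
  set P := ρ₁ * ρ₂.transpose with hPdef
  -- `t = 0` is the reference point for the increments of both angles
  have hcos := fun t => cos_eq_one_of_rotZ_comm hP (rotZ_mul_comm_of_frames (h 0) (h t))
  have hα : Continuous fun t => angleAt r₁ ρ₁ (γ t) - angleAt r₁ ρ₁ (γ 0) :=
    ((contDiff_angleAt r₁ ρ₁).continuous.comp hγ).sub continuous_const
  have hβ : Continuous fun t => angleAt r₂ ρ₂ (γ t) - angleAt r₂ ρ₂ (γ 0) :=
    ((contDiff_angleAt r₂ ρ₂).continuous.comp hγ).sub continuous_const
  -- the first row of `ρ₁ = P * ρ₂`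
  have hrow : ∀ j, ρ₁ 0 j = P 0 0 * ρ₂ 0 j + P 0 1 * ρ₂ 1 j := fun j => by
    conv_lhs => rw [← hPρ]
    rw [Matrix.mul_apply, Fin.sum_univ_two]
  have hb : P 0 1 = 0 := by
    by_contra hb
    have h₁ := eq_zero_of_cos_eq_one hα (sub_self _) (fun t => ((hcos t).1 hb).1) 1
    have h₂ := eq_zero_of_cos_eq_one hβ (sub_self _) (fun t => ((hcos t).1 hb).2) 1
    have hs₁ := congrArg (fun s => s * r₁) h₁
    have hs₂ := congrArg (fun s => s * r₂) h₂
    simp only [angleAt_eq, hrow, sub_mul, div_mul_cancel₀ _ hr₁.ne', zero_mul] at hs₁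
    simp only [angleAt_eq, sub_mul, div_mul_cancel₀ _ hr₂.ne', zero_mul] at hs₂
    -- the rows `ρ₁ 0` and `ρ₂ 0` are independent, so `γ 1 - γ 0` vanishes
    have h10 : P 0 1 * (ρ₂ 1 0 * (γ 1 0 - γ 0 0) + ρ₂ 1 1 * (γ 1 1 - γ 0 1)) = 0 := by
      linear_combination hs₁ - P 0 0 * hs₂
    have hs₃ := (mul_eq_zero.1 h10).resolve_left hb
    have ho : ρ₂.transpose * ρ₂ = 1 := (Matrix.mem_orthogonalGroup_iff' (Fin 2) ℝ).1 hρ₂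
    have o00 := congrFun (congrFun ho 0) 0
    have o01 := congrFun (congrFun ho 0) 1
    have o11 := congrFun (congrFun ho 1) 1
    simp [Matrix.mul_apply, Fin.sum_univ_two] at o00 o01 o11
    have : γ 1 = γ 0 := by
      ext j
      fin_cases j
      · change γ 1 0 = γ 0 0
        linear_combination ρ₂ 0 0 * hs₂ + ρ₂ 1 0 * hs₃ - (γ 1 0 - γ 0 0) * o00 -
          (γ 1 1 - γ 0 1) * o01
      · change γ 1 1 = γ 0 1
        linear_combination ρ₂ 0 1 * hs₂ + ρ₂ 1 1 * hs₃ - (γ 1 0 - γ 0 0) * o01 -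
          (γ 1 1 - γ 0 1) * o11
    exact one_ne_zero (hinj this)
  refine ⟨hb, fun t => ?_⟩
  obtain ⟨σ₁, σ₂, hσ₁, hσ₂, hdiag⟩ := exists_eq_diagonal_of_mem hP hb
  have p00 : P 0 0 = σ₁ := by simp [hdiag]
  have p11 : P 1 1 = σ₂ := by simp [hdiag]
  have hdP : ρ₁.det = σ₁ * σ₂ * ρ₂.det := by
    conv_lhs => rw [← hPρ]
    rw [Matrix.det_mul, hdiag, Matrix.det_diagonal]
    simp [Fin.prod_univ_two]
  have hd2 : ρ₂.det ≠ 0 := by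
    intro h0
    have := congrArg Matrix.det ((Matrix.mem_orthogonalGroup_iff (Fin 2) ℝ).1 hρ₂)
    simp [h0] at this
  have h₁ := eq_zero_of_cos_eq_one (hα.sub (hβ.const_mul (P 1 1))) (by simp)
    (fun t => (hcos t).2 hb) t
  have e₁ : angleAt r₁ ρ₁ (γ t) - angleAt r₁ ρ₁ (γ 0) =
      σ₁ * r₂ / r₁ * (angleAt r₂ ρ₂ (γ t) - angleAt r₂ ρ₂ (γ 0)) := by
    simp only [angleAt_eq, hrow, hb, p00]
    field_simp
    ring
  -- equality would mean `r₁ = r₂` and `σ₁ = σ₂`, that is `det ρ₁ = det ρ₂`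
  have hne : σ₁ * r₂ / r₁ - σ₂ ≠ 0 := by
    intro h0
    have h1 : σ₁ * r₂ = σ₂ * r₁ := by
      field_simp at h0
      linarith
    rcases hσ₁ with hσ₁ | hσ₁ <;> rcases hσ₂ with hσ₂ | hσ₂ <;> rw [hσ₁, hσ₂] at h1 hdP
    · have := hdet (by linarith)
      exact hd2 (by linarith)
    · linarith
    · linarith
    · have := hdet (by linarith)
      exact hd2 (by linarith)
  have h₂ : (σ₁ * r₂ / r₁ - σ₂) * (angleAt r₂ ρ₂ (γ t) - angleAt r₂ ρ₂ (γ 0)) = 0 := by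
    rw [sub_mul, ← e₁, ← p11]
    exact h₁
  exact sub_eq_zero.1 ((mul_eq_zero.1 h₂).resolve_left hne)

/-- An arc contained in a line is a segment. -/
theorem isSegmentAlong_range {γ : unitInterval → E2}
    (hinj : Function.Injective γ) {e : E2} {c : unitInterval → ℝ} (hc : Continuous c)
    (h : ∀ t, γ t = γ 0 + c t • e) : IsSegmentAlong (range γ) e := by
  have hcomp : IsCompact (range c) := isCompact_range hc
  obtain ⟨t₀, ht₀⟩ := hcomp.sInf_mem (range_nonempty c)
  obtain ⟨t₁, ht₁⟩ := hcomp.sSup_mem (range_nonempty c)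
  have hrange : range c = Icc (c t₀) (c t₁) := by
    rw [ht₀, ht₁]
    exact eq_Icc_of_connected_compact (isConnected_range hc) hcomp
  have hle : ∀ t, c t₀ ≤ c t ∧ c t ≤ c t₁ := fun t => by
    have : c t ∈ range c := mem_range_self t
    rwa [hrange] at this
  have hlt : c t₀ < c t₁ := by
    refine lt_of_le_of_ne (hle t₁).1 fun heq => zero_ne_one (α := unitInterval) (hinj ?_)
    have e0 := hle 0
    have e1 := hle 1
    rw [h 1]
    have : c 0 • e = 0 := by simpa using h 0
    rw [show c 1 = c 0 by linarith, this, add_zero]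
  refine ⟨γ 0 + c t₀ • e, c t₁ - c t₀, sub_pos.2 hlt, ?_⟩
  ext x
  rw [segment_eq_image']
  constructor
  · rintro ⟨t, rfl⟩
    have hne : c t₁ - c t₀ ≠ 0 := (sub_pos.2 hlt).ne'
    refine ⟨(c t - c t₀) / (c t₁ - c t₀), ⟨?_, ?_⟩, ?_⟩
    · exact div_nonneg (sub_nonneg.2 (hle t).1) (sub_pos.2 hlt).le
    · rw [div_le_one (sub_pos.2 hlt)]
      linarith [(hle t).2]
    · simp only [h t, add_sub_cancel_left, smul_smul, div_mul_cancel₀ _ hne]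
      module
  · rintro ⟨s, ⟨hs0, hs1⟩, rfl⟩
    have : c t₀ + s * (c t₁ - c t₀) ∈ range c := by
      rw [hrange]
      constructor
      · nlinarith
      · nlinarith
    obtain ⟨t, ht⟩ := this
    refine ⟨t, ?_⟩
    simp only [h t, ht, add_sub_cancel_left]
    module

/-! ### Propagation along a common ruling -/

theorem angleAt_add_smul_ruling (r : ℝ) {ρ : Matrix (Fin 2) (Fin 2) ℝ}
    (hρ : ρ ∈ Matrix.orthogonalGroup (Fin 2) ℝ) (p : E2) (s : ℝ) :
    angleAt r ρ (p + s • ruling ρ) = angleAt r ρ p := by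
  have h := congrFun (congrFun ((Matrix.mem_orthogonalGroup_iff (Fin 2) ℝ).1 hρ) 0) 1
  simp [Matrix.mul_apply, Fin.sum_univ_two] at h
  rw [angleAt_eq, angleAt_eq]
  congr 1
  simp only [PiLp.add_apply, PiLp.smul_apply, ruling_apply, smul_eq_mul]
  linear_combination s * h

theorem cyl_add_smul_ruling (v : E3) (R : Matrix (Fin 3) (Fin 3) ℝ) (r : ℝ)
    {ρ : Matrix (Fin 2) (Fin 2) ℝ} (hρ : ρ ∈ Matrix.orthogonalGroup (Fin 2) ℝ) (p : E2) (s : ℝ)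
    (j : Fin 3) : cyl v R r ρ (p + s • ruling ρ) j = cyl v R r ρ p j + s * R j 2 := by
  have h := congrFun (congrFun ((Matrix.mem_orthogonalGroup_iff (Fin 2) ℝ).1 hρ) 1) 1
  simp [Matrix.mul_apply, Fin.sum_univ_two] at h
  rw [cyl_apply, cyl_apply, angleAt_add_smul_ruling r hρ]
  simp only [PiLp.add_apply, PiLp.smul_apply, ruling_apply, smul_eq_mul]
  linear_combination s * R j 2 * h

theorem ruling_ne_zero {ρ : Matrix (Fin 2) (Fin 2) ℝ}
    (hρ : ρ ∈ Matrix.orthogonalGroup (Fin 2) ℝ) : ruling ρ ≠ 0 := by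
  intro h0
  have h := congrFun (congrFun ((Matrix.mem_orthogonalGroup_iff (Fin 2) ℝ).1 hρ) 1) 1
  have h1 : ∀ j, ρ 1 j = 0 := fun j => by
    rw [← ruling_apply ρ j, h0]
    rfl
  simp [Matrix.mul_apply, h1] at h

/-- A displacement which preserves the angle is parallel to the ruling. -/
theorem eq_add_smul_ruling {r : ℝ} (hr : r ≠ 0) {ρ : Matrix (Fin 2) (Fin 2) ℝ}
    (hρ : ρ ∈ Matrix.orthogonalGroup (Fin 2) ℝ) {p q : E2}
    (h : angleAt r ρ q = angleAt r ρ p) :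
    q = p + (ρ 1 0 * (q 0 - p 0) + ρ 1 1 * (q 1 - p 1)) • ruling ρ := by
  rw [angleAt_eq, angleAt_eq, div_left_inj' hr] at h
  have ho : ρ.transpose * ρ = 1 := (Matrix.mem_orthogonalGroup_iff' (Fin 2) ℝ).1 hρ
  have o00 := congrFun (congrFun ho 0) 0
  have o01 := congrFun (congrFun ho 0) 1
  have o11 := congrFun (congrFun ho 1) 1
  simp [Matrix.mul_apply, Fin.sum_univ_two] at o00 o01 o11
  ext j
  simp only [PiLp.add_apply, PiLp.smul_apply, ruling_apply, smul_eq_mul]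
  fin_cases j
  · change q 0 = p 0 + _ * ρ 1 0
    linear_combination ρ 0 0 * h - (q 0 - p 0) * o00 - (q 1 - p 1) * o01
  · change q 1 = p 1 + _ * ρ 1 1
    linear_combination ρ 0 1 * h - (q 0 - p 0) * o01 - (q 1 - p 1) * o11

theorem ruling_eq_smul_of_eq_diagonal {ρ₁ ρ₂ : Matrix (Fin 2) (Fin 2) ℝ}
    (hρ₂ : ρ₂ ∈ Matrix.orthogonalGroup (Fin 2) ℝ) {σ₁ σ₂ : ℝ}
    (h : ρ₁ * ρ₂.transpose = Matrix.diagonal ![σ₁, σ₂]) : ruling ρ₁ = σ₂ • ruling ρ₂ := by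
  have hPρ := mul_transpose_mul_cancel (ρ₁ := ρ₁) hρ₂
  rw [h] at hPρ
  ext j
  rw [PiLp.smul_apply, ruling_apply, ruling_apply, ← hPρ, Matrix.diagonal_mul]
  simp

/-- First-order contact at one point propagates along a common ruling. -/
theorem contact_of_contact_at_point {R₁ R₂ : Matrix (Fin 3) (Fin 3) ℝ}
    (hR₁ : R₁ ∈ Matrix.specialOrthogonalGroup (Fin 3) ℝ)
    (hR₂ : R₂ ∈ Matrix.specialOrthogonalGroup (Fin 3) ℝ) {v₁ v₂ : E3} {r₁ r₂ : ℝ}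
    {ρ₁ ρ₂ : Matrix (Fin 2) (Fin 2) ℝ} (hρ₁ : ρ₁ ∈ Matrix.orthogonalGroup (Fin 2) ℝ)
    (hρ₂ : ρ₂ ∈ Matrix.orthogonalGroup (Fin 2) ℝ) {σ₁ σ₂ : ℝ} (hσ₂ : σ₂ = 1 ∨ σ₂ = -1)
    (hP : ρ₁ * ρ₂.transpose = Matrix.diagonal ![σ₁, σ₂]) {p : E2}
    (hQ : (R₁ * rotZ (angleAt r₁ ρ₁ p)).transpose * (R₂ * rotZ (angleAt r₂ ρ₂ p)) =
      Matrix.diagonal ![σ₁ * σ₂, σ₁, σ₂])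
    (hv : cyl v₁ R₁ r₁ ρ₁ p = cyl v₂ R₂ r₂ ρ₂ p) (s : ℝ) :
    cyl v₁ R₁ r₁ ρ₁ (p + s • ruling ρ₂) = cyl v₂ R₂ r₂ ρ₂ (p + s • ruling ρ₂) ∧
      ∀ i, cylD R₁ r₁ ρ₁ i (p + s • ruling ρ₂) = cylD R₂ r₂ ρ₂ i (p + s • ruling ρ₂) := by
  have hrul := ruling_eq_smul_of_eq_diagonal hρ₂ hP
  have hrul' : ruling ρ₂ = σ₂ • ruling ρ₁ := by
    rw [hrul, smul_smul, mul_self_eq_one_iff.2 hσ₂, one_smul]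
  constructor
  · ext j
    rw [cyl_add_smul_ruling v₂ R₂ r₂ hρ₂, hrul', smul_smul, cyl_add_smul_ruling v₁ R₁ r₁ hρ₁, hv]
    have hM : R₂ * rotZ (angleAt r₂ ρ₂ p) =
        R₁ * rotZ (angleAt r₁ ρ₁ p) * Matrix.diagonal ![σ₁ * σ₂, σ₁, σ₂] := by
      rw [← hQ, ← mul_assoc, self_mul_transpose_of_mem (mul_rotZ_mem hR₁ _), one_mul]
    have hj := congrFun (congrFun hM j) 2
    rw [Matrix.mul_diagonal, Matrix.mul_apply, Matrix.mul_apply] at hj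
    simp [rotZ, Fin.sum_univ_three] at hj
    rw [hj]
    ring
  · rw [cylD_eq_iff hR₁ hR₂ hρ₂, angleAt_add_smul_ruling r₂ hρ₂, hrul', smul_smul,
      angleAt_add_smul_ruling r₁ hρ₁, hQ, hP, blockDet_diagonal]

/-! ### Gluing two cylinders -/

theorem memLp_of_isBounded {Ω : Set E2} (hb : Bornology.IsBounded Ω)
    {f : E2 → E3} (hf : Continuous f) : MemLp f 2 (volume.restrict Ω) := by
  obtain ⟨C, hC⟩ := (hb.isCompact_closure.image hf).isBounded.exists_norm_le
  have : IsFiniteMeasure (volume.restrict Ω) := ⟨by simpa using hb.measure_lt_top⟩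
  have hcl : MemLp f 2 (volume.restrict (closure Ω)) := by
    have : IsFiniteMeasure (volume.restrict (closure Ω)) :=
      ⟨by simpa using hb.closure.measure_lt_top⟩
    exact MemLp.of_bound hf.aestronglyMeasurable C
      ((ae_restrict_iff' isClosed_closure.measurableSet).2
        (Eventually.of_forall fun x hx => hC _ (mem_image_of_mem f hx)))
  exact hcl.mono_measure (Measure.restrict_mono subset_closure le_rfl)

theorem memLp_piecewise {Ω U₁ U₂ : Set E2} (hb : Bornology.IsBounded Ω) (h₁ : IsOpen U₁)
    (h₂ : IsOpen U₂) {f₁ f₂ : E2 → E3} (hf₁ : Continuous f₁) (hf₂ : Continuous f₂) :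
    MemLp (fun x => U₁.indicator f₁ x + U₂.indicator f₂ x) 2 (volume.restrict Ω) :=
  ((memLp_of_isBounded hb hf₁).indicator h₁.measurableSet).add
    ((memLp_of_isBounded hb hf₂).indicator h₂.measurableSet)

/-- Two cylinders with first-order contact along the interface glue to a `W^{2,2}` isometry. -/
theorem memW22Iso_of_contact {Ω U₁ U₂ : Set E2} (hΩ : IsOpen Ω) (hb : Bornology.IsBounded Ω)
    (h₁ : IsOpen U₁) (h₂ : IsOpen U₂) (hs₁ : U₁ ⊆ Ω) (hs₂ : U₂ ⊆ Ω) (hd : Disjoint U₁ U₂)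
    (hnull : volume (Ω \ (U₁ ∪ U₂)) = 0) {v₁ v₂ : E3} {R₁ R₂ : Matrix (Fin 3) (Fin 3) ℝ}
    (hR₁ : R₁ ∈ Matrix.specialOrthogonalGroup (Fin 3) ℝ)
    (hR₂ : R₂ ∈ Matrix.specialOrthogonalGroup (Fin 3) ℝ) {r₁ r₂ : ℝ} (hr₁ : r₁ ≠ 0)
    (hr₂ : r₂ ≠ 0) {ρ₁ ρ₂ : Matrix (Fin 2) (Fin 2) ℝ}
    (hρ₁ : ρ₁ ∈ Matrix.orthogonalGroup (Fin 2) ℝ) (hρ₂ : ρ₂ ∈ Matrix.orthogonalGroup (Fin 2) ℝ)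
    {y : E2 → E3} (hy : y =ᵐ[volume.restrict Ω] fun x =>
      U₁.indicator (cyl v₁ R₁ r₁ ρ₁) x + U₂.indicator (cyl v₂ R₂ r₂ ρ₂) x)
    (hc : ∀ x ∈ Ω, x ∉ U₁ → x ∉ U₂ → cyl v₁ R₁ r₁ ρ₁ x = cyl v₂ R₂ r₂ ρ₂ x ∧
      ∀ i, cylD R₁ r₁ ρ₁ i x = cylD R₂ r₂ ρ₂ i x) : MemW22Iso Ω y := by
  have hC : ∀ v R r ρ, ContDiff ℝ 1 (cyl v R r ρ) := fun v R r ρ =>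
    (contDiff_cyl v R r ρ).of_le (by exact_mod_cast le_top)
  have hD : ∀ R r ρ i, ContDiff ℝ 1 (cylD R r ρ i) := fun R r ρ i =>
    (contDiff_cylD R r ρ i).of_le (by exact_mod_cast le_top)
  have hDc : ∀ R r ρ i j, Continuous fun x => fderiv ℝ (cylD R r ρ i) x (stdE j) :=
    fun R r ρ i j => ((hD R r ρ i).continuous_fderiv one_ne_zero).clm_apply continuous_const
  let d : Fin 2 → E2 → E3 := fun i x =>
    U₁.indicator (cylD R₁ r₁ ρ₁ i) x + U₂.indicator (cylD R₂ r₂ ρ₂ i) x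
  refine ⟨d, ⟨(memLp_piecewise hb h₁ h₂ (hC _ _ _ _).continuous
    (hC _ _ _ _).continuous).ae_eq hy.symm, fun i => ⟨memLp_piecewise hb h₁ h₂
      (hD _ _ _ _).continuous (hD _ _ _ _).continuous, ?_⟩,
    fun i j x => U₁.indicator (fun x => fderiv ℝ (cylD R₁ r₁ ρ₁ i) x (stdE j)) x +
      U₂.indicator (fun x => fderiv ℝ (cylD R₂ r₂ ρ₂ i) x (stdE j)) x, fun i j =>
      ⟨memLp_piecewise hb h₁ h₂ (hDc _ _ _ _ _) (hDc _ _ _ _ _), ?_⟩⟩, ?_⟩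
  · refine isWeakPartial_piecewise h₁ h₂ hs₁ hs₂ hd hnull (hC _ _ _ _) (hC _ _ _ _) hy i
      (Eventually.of_forall fun x => ?_) fun x hx hx₁ hx₂ => (hc x hx hx₁ hx₂).1
    simp only [fderiv_cyl _ _ hr₁, fderiv_cyl _ _ hr₂]
    rfl
  · exact isWeakPartial_piecewise h₁ h₂ hs₁ hs₂ hd hnull (hD _ _ _ _) (hD _ _ _ _)
      EventuallyEq.rfl j EventuallyEq.rfl fun x hx hx₁ hx₂ => (hc x hx hx₁ hx₂).2 i
  · rw [ae_restrict_iff' hΩ.measurableSet]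
    filter_upwards [compl_mem_ae_iff.2 hnull] with x hx hxΩ
    have hxU : x ∈ U₁ ∪ U₂ := by
      by_contra hcon
      exact hx ⟨hxΩ, hcon⟩
    rcases hxU with hxU | hxU
    · have hxU' : x ∉ U₂ := fun h => hd.le_bot ⟨hxU, h⟩
      have : ∀ i, d i x = cylD R₁ r₁ ρ₁ i x := fun i => by simp [d, hxU, hxU']
      rw [this, this, norm_cylD hR₁ _ hρ₁, norm_cylD hR₁ _ hρ₁, inner_cylD hR₁ _ hρ₁]
      simp
    · have hxU' : x ∉ U₁ := fun h => hd.le_bot ⟨h, hxU⟩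
      have : ∀ i, d i x = cylD R₂ r₂ ρ₂ i x := fun i => by simp [d, hxU, hxU']
      rw [this, this, norm_cylD hR₂ _ hρ₂, norm_cylD hR₂ _ hρ₂, inner_cylD hR₂ _ hρ₂]
      simp

/-- A `W^{2,2}` map glued from two cylinders has first-order contact along the interface. -/
theorem contact_of_memW22Iso {Ω U₁ U₂ : Set E2} (hΩ : IsOpen Ω) (hb : Bornology.IsBounded Ω)
    (h₁ : IsLipschitzOpen U₁) (h₂ : IsLipschitzOpen U₂) (hs₁ : U₁ ⊆ Ω) (hs₂ : U₂ ⊆ Ω)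
    (hd : Disjoint U₁ U₂) (hnull : volume (Ω \ (U₁ ∪ U₂)) = 0) {v₁ v₂ : E3}
    {R₁ R₂ : Matrix (Fin 3) (Fin 3) ℝ} {r₁ r₂ : ℝ} (hr₁ : r₁ ≠ 0)
    (hr₂ : r₂ ≠ 0) {ρ₁ ρ₂ : Matrix (Fin 2) (Fin 2) ℝ}
    {y : E2 → E3} (hy : y =ᵐ[volume.restrict Ω] fun x =>
      U₁.indicator (cyl v₁ R₁ r₁ ρ₁) x + U₂.indicator (cyl v₂ R₂ r₂ ρ₂) x)
    (h : MemW22Iso Ω y) {x : E2} (hx : x ∈ Ω) (hx₁ : x ∉ U₁) (hx₂ : x ∉ U₂) :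
    cyl v₁ R₁ r₁ ρ₁ x = cyl v₂ R₂ r₂ ρ₂ x ∧ ∀ i, cylD R₁ r₁ ρ₁ i x = cylD R₂ r₂ ρ₂ i x := by
  obtain ⟨d, ⟨-, hd₁, g, hg⟩, -⟩ := h
  have hfin : volume Ω ≠ ⊤ := hb.measure_lt_top.ne
  have : IsFiniteMeasure (volume.restrict Ω) := ⟨by simpa using hfin.lt_top⟩
  have hloc : ∀ f : E2 → E3, MemLp f 2 (volume.restrict Ω) → LocallyIntegrableOn f Ω :=
    fun f hf => IntegrableOn.locallyIntegrableOn (hf.integrable one_le_two)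
  refine ⟨eq_of_isWeakPartial_piecewise hΩ hfin h₁ h₂ hs₁ hs₂ hd hnull (contDiff_cyl _ _ _ _)
    (contDiff_cyl _ _ _ _) hy (fun i => hloc _ (hd₁ i).1) (fun i => (hd₁ i).2) hx hx₁ hx₂,
    fun i => ?_⟩
  have hdi := ae_eq_piecewise_fderiv hΩ h₁.1 h₂.1 hs₁ hs₂ hd hnull
    ((contDiff_cyl v₁ R₁ r₁ ρ₁).of_le (by exact_mod_cast le_top))
    ((contDiff_cyl v₂ R₂ r₂ ρ₂).of_le (by exact_mod_cast le_top)) hy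
    (hloc _ (hd₁ i).1) (hd₁ i).2
  simp only [fderiv_cyl _ _ hr₁, fderiv_cyl _ _ hr₂] at hdi
  exact eq_of_isWeakPartial_piecewise hΩ hfin h₁ h₂ hs₁ hs₂ hd hnull (contDiff_cylD _ _ _ _)
    (contDiff_cylD _ _ _ _) hdi (fun j => hloc _ (hg i j).1) (fun j => (hg i j).2) hx hx₁ hx₂

theorem IsComponentOf.subset {C S : Set E2} (h : IsComponentOf C S) : C ⊆ S := by
  obtain ⟨x, -, rfl⟩ := h
  exact connectedComponentIn_subset S x

theorem IsComponentOf.disjoint {C D S : Set E2} (hC : IsComponentOf C S)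
    (hD : IsComponentOf D S) (hne : C ≠ D) : Disjoint C D := by
  obtain ⟨x, -, rfl⟩ := hC
  obtain ⟨z, -, rfl⟩ := hD
  rw [Set.disjoint_left]
  intro q hq hq'
  exact hne ((connectedComponentIn_eq hq).trans (connectedComponentIn_eq hq').symm)

/-- The part of the cut which lies in the domain is contained in the two Lipschitz
boundaries because an arc has empty interior. -/
theorem volume_sdiff_components {ω ω₁ ω₂ : Set E2} (hω : IsOpen ω) {γ : unitInterval → E2}
    (hγ : Continuous γ) (hinj : Function.Injective γ)
    (hcover : ω \ range γ = ω₁ ∪ ω₂) (h₁ : IsLipschitzOpen ω₁) (h₂ : IsLipschitzOpen ω₂) :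
    volume (ω \ (ω₁ ∪ ω₂)) = 0 := by
  refine measure_mono_null (t := frontier ω₁ ∪ frontier ω₂) ?_
    (measure_union_null h₁.volume_frontier h₂.volume_frontier)
  rintro q ⟨hq, hqn⟩
  have hcl : q ∈ closure (ω₁ ∪ ω₂) := by
    rw [mem_closure_iff]
    intro V hV hqV
    by_contra hne
    have hsub : V ∩ ω ⊆ range γ := fun z hz => by
      by_contra hzγ
      exact hne ⟨z, hz.1, hcover ▸ ⟨hz.2, hzγ⟩⟩
    have := interior_maximal hsub (hV.inter hω) ⟨hqV, hq⟩
    rw [interior_range_arc hγ hinj] at this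
    exact this
  rw [closure_union] at hcl
  rw [h₁.1.frontier_eq, h₂.1.frontier_eq]
  exact hcl.imp (fun h => ⟨h, fun h' => hqn (Or.inl h')⟩) fun h => ⟨h, fun h' => hqn (Or.inr h')⟩

/-- A closed condition which holds in the interior of an arc holds at its endpoints. -/
theorem forall_of_forall_ne_endpoints {γ : unitInterval → E2} (hγ : Continuous γ) {Z : Set E2}
    (hZ : IsClosed Z) (h : ∀ t, t ≠ 0 → t ≠ 1 → γ t ∈ Z) (t : unitInterval) : γ t ∈ Z := by
  let Γ : ℝ → E2 := fun s => γ (projIcc 0 1 zero_le_one s)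
  have hΓ : Continuous Γ := hγ.comp continuous_projIcc
  have hsub : Ioo (0 : ℝ) 1 ⊆ Γ ⁻¹' Z := by
    intro s hs
    have hs' : s ∈ Icc (0 : ℝ) 1 := ⟨hs.1.le, hs.2.le⟩
    change γ _ ∈ Z
    rw [projIcc_of_mem zero_le_one hs']
    refine h _ (fun h0 => hs.1.ne' (congrArg Subtype.val h0))
      fun h1 => hs.2.ne (congrArg Subtype.val h1)
  have := closure_minimal hsub (hZ.preimage hΓ)
  rw [closure_Ioo zero_ne_one] at this
  have ht : Γ t ∈ Z := this t.2
  simpa [Γ] using ht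

end CylinderPatch

theorem lemma3p3
    -- a bounded Lipschitz domain
    (ω : Set E2) (hω_bdd : Bornology.IsBounded ω) (hω_conn : IsConnected ω)
    (hω_lip : IsLipschitzOpen ω)
    -- an injective curve, and the two components into which it splits the domain
    (γ : unitInterval → E2) (hγ_cont : Continuous γ) (hγ_inj : Function.Injective γ)
    (hγ_mem : ∀ t, γ t ∈ closure ω)
    (hγ_bdry : Set.range γ ∩ frontier ω = {γ 0, γ 1})
    (ω₁ ω₂ : Set E2) (hω₁ : IsComponentOf ω₁ (ω \ Set.range γ))
    (hω₂ : IsComponentOf ω₂ (ω \ Set.range γ)) (hne : ω₁ ≠ ω₂)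
    (hcover : ω \ Set.range γ = ω₁ ∪ ω₂)
    (hω₁_lip : IsLipschitzOpen ω₁) (hω₂_lip : IsLipschitzOpen ω₂)
    -- two cylinders of finite radii
    (v₁ v₂ : E3) (R₁ R₂ : Matrix (Fin 3) (Fin 3) ℝ)
    (hR₁ : R₁ ∈ Matrix.specialOrthogonalGroup (Fin 3) ℝ)
    (hR₂ : R₂ ∈ Matrix.specialOrthogonalGroup (Fin 3) ℝ)
    (r₁ r₂ : ℝ) (hr₁ : 0 < r₁) (hr₂ : 0 < r₂)
    (ρ₁ ρ₂ : Matrix (Fin 2) (Fin 2) ℝ)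
    (hρ₁ : ρ₁ ∈ Matrix.orthogonalGroup (Fin 2) ℝ)
    (hρ₂ : ρ₂ ∈ Matrix.orthogonalGroup (Fin 2) ℝ)
    (hdet : r₁ = r₂ → ρ₁.det = -ρ₂.det)
    -- the glued map, given almost everywhere
    (y : E2 → E3)
    (hy : y =ᵐ[volume.restrict ω] fun x =>
      ω₁.indicator (cyl v₁ R₁ r₁ ρ₁) x + ω₂.indicator (cyl v₂ R₂ r₂ ρ₂) x) :
    -- parallel rulings make `ρ₁ ρ₂ᵀ` a diagonal matrix of signs
    (∀ e : E2, e ≠ 0 → IsParallel (ruling ρ₁) e → IsParallel (ruling ρ₂) e →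
      ∃ σ₁ σ₂ : ℝ, (σ₁ = 1 ∨ σ₁ = -1) ∧ (σ₂ = 1 ∨ σ₂ = -1) ∧
        ρ₁ * ρ₂.transpose = Matrix.diagonal ![σ₁, σ₂]) ∧
    (MemW22Iso ω y ↔
      ∃ e : E2, e ≠ 0 ∧
        -- (i)
        IsSegmentAlong (Set.range γ) e ∧
        -- (ii)
        IsParallel (ruling ρ₁) e ∧ IsParallel (ruling ρ₂) e ∧
        -- (iii)
        (∃ σ₁ σ₂ : ℝ, (σ₁ = 1 ∨ σ₁ = -1) ∧ (σ₂ = 1 ∨ σ₂ = -1) ∧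
          ρ₁ * ρ₂.transpose = Matrix.diagonal ![σ₁, σ₂] ∧
          (R₁ * rotZ (angleAt r₁ ρ₁ (γ 0))).transpose * (R₂ * rotZ (angleAt r₂ ρ₂ (γ 0))) =
            Matrix.diagonal ![σ₁ * σ₂, σ₁, σ₂]) ∧
        v₁ + R₁.toEuclideanLin (stdCyl r₁ (ρ₁.toEuclideanLin (γ 0))) =
          v₂ + R₂.toEuclideanLin (stdCyl r₂ (ρ₂.toEuclideanLin (γ 0)))) := by
  have hω := hω_lip.1
  have hs₁ : ω₁ ⊆ ω := hω₁.subset.trans Set.sdiff_subset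
  have hs₂ : ω₂ ⊆ ω := hω₂.subset.trans Set.sdiff_subset
  have hd := hω₁.disjoint hω₂ hne
  have hnull := volume_sdiff_components hω hγ_cont hγ_inj hcover hω₁_lip hω₂_lip
  have hout : ∀ x ∈ ω, (x ∈ Set.range γ ↔ x ∉ ω₁ ∧ x ∉ ω₂) := by
    intro x hx
    rw [← not_or, ← Set.mem_union, ← hcover]
    exact ⟨fun h h' => h'.2 h, fun h => not_not.1 fun h' => h ⟨hx, h'⟩⟩
  refine ⟨fun e _ h₁ h₂ => exists_eq_diagonal_of_isParallel hρ₁ hρ₂ h₁ h₂, ?_, ?_⟩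
  · intro h
    have hcontact : ∀ t, cyl v₁ R₁ r₁ ρ₁ (γ t) = cyl v₂ R₂ r₂ ρ₂ (γ t) ∧
        ∀ i, cylD R₁ r₁ ρ₁ i (γ t) = cylD R₂ r₂ ρ₂ i (γ t) := by
      refine forall_of_forall_ne_endpoints hγ_cont (Z := {x | cyl v₁ R₁ r₁ ρ₁ x =
        cyl v₂ R₂ r₂ ρ₂ x ∧ ∀ i, cylD R₁ r₁ ρ₁ i x = cylD R₂ r₂ ρ₂ i x}) ?_ fun t h0 h1 => ?_
      · simp only [Set.ofPred_and, Set.ofPred_forall]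
        exact (isClosed_eq (contDiff_cyl _ _ _ _).continuous
          (contDiff_cyl _ _ _ _).continuous).inter (isClosed_iInter fun i =>
            isClosed_eq (contDiff_cylD _ _ _ _).continuous (contDiff_cylD _ _ _ _).continuous)
      · have hmem : γ t ∈ ω := by
          by_contra hnot
          have : γ t ∈ Set.range γ ∩ frontier ω :=
            ⟨Set.mem_range_self t, by rw [hω.frontier_eq]; exact ⟨hγ_mem t, hnot⟩⟩
          rw [hγ_bdry] at this
          rcases this with h | h
          · exact h0 (hγ_inj h)
          · exact h1 (hγ_inj h)
        have hn := (hout _ hmem).1 (Set.mem_range_self t)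
        exact contact_of_memW22Iso hω hω_bdd hω₁_lip hω₂_lip hs₁ hs₂ hd hnull hr₁.ne' hr₂.ne' hy h
          hmem hn.1 hn.2
    have hframe := fun t => (cylD_eq_iff hR₁ hR₂ hρ₂).1 (hcontact t).2
    obtain ⟨hP, hangle⟩ := contact_along_ruling hr₁ hr₂ hρ₁ hρ₂ hdet hγ_cont hγ_inj hframe
    obtain ⟨σ₁, σ₂, hσ₁, hσ₂, hdiag⟩ := exists_eq_diagonal_of_mem (mul_transpose_mem hρ₁ hρ₂) hP
    refine ⟨ruling ρ₂, ruling_ne_zero hρ₂, ?_, ⟨σ₂, ruling_eq_smul_of_eq_diagonal hρ₂ hdiag⟩,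
      ⟨1, (one_smul ℝ _).symm⟩, ⟨σ₁, σ₂, hσ₁, hσ₂, hdiag, ?_⟩, (hcontact 0).1⟩
    · exact isSegmentAlong_range hγ_inj
        (c := fun t => ρ₂ 1 0 * (γ t 0 - γ 0 0) + ρ₂ 1 1 * (γ t 1 - γ 0 1)) (by fun_prop)
        fun t => eq_add_smul_ruling hr₂.ne' hρ₂ (hangle t)
    · rw [hframe 0, hdiag, blockDet_diagonal]
  · rintro ⟨e, he, ⟨p, l, hl, hseg⟩, -, ⟨c, hc⟩, ⟨σ₁, σ₂, hσ₁, hσ₂, hdiag, hQ⟩, hv⟩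
    refine memW22Iso_of_contact hω hω_bdd hω₁_lip.1 hω₂_lip.1 hs₁ hs₂ hd hnull hR₁ hR₂ hr₁.ne'
      hr₂.ne' hρ₁ hρ₂ hy fun x hx hx₁ hx₂ => ?_
    have hline : ∀ z ∈ Set.range γ, ∃ s : ℝ, z = p + s • e := by
      intro z hz
      rw [hseg, segment_eq_image'] at hz
      obtain ⟨s, -, rfl⟩ := hz
      exact ⟨s * l, by simp [smul_smul]⟩
    obtain ⟨s, hs⟩ := hline x ((hout x hx).2 ⟨hx₁, hx₂⟩)
    obtain ⟨s₀, hs₀⟩ := hline (γ 0) (Set.mem_range_self 0)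
    have hc0 : c ≠ 0 := by
      rintro rfl
      exact ruling_ne_zero hρ₂ (by simpa using hc)
    have hxe : x = γ 0 + ((s - s₀) / c) • ruling ρ₂ := by
      rw [hs, hs₀, hc, smul_smul, div_mul_cancel₀ _ hc0]
      module
    rw [hxe]
    exact contact_of_contact_at_point hR₁ hR₂ hρ₁ hρ₂ hσ₂ hdiag hQ hv _
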